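/- Let $N\ge 1$, $\hbar,m,\omega>0$ and $D>-m\omega^2/N$. Consider on $L^2(\mathbb{R}^N)=L^2(\mathbb{R})^{\otimes N}$ the Hamiltonian of the one-dimensional $N$-Harmonium $$H=\sum_{i=1}^N\Big(-\frac{\hbar^2}{2m}\,\partial_i^2+\frac12 m\omega^2x_i^2\Big)+\frac12 D\sum_{1\le i<j\le N}(x_i-x_j)^2 ,$$ with domain all $\Psi\in L^2(\mathbb{R}^N)$ for which $H\Psi$, taken in the sense of distributions, is in $L^2(\mathbb{R}^N)$. Put $d_-=m\omega^2$, $d_+=m\omega^2+ND$, $\omega_\pm=\sqrt{d_\pm/m}$, $l_\pm=\sqrt{\hbar/(m\omega_\pm)}$, $$A=\frac1{2l_+^2},\qquad B_N=\frac1{2N}\Big(\frac1{l_+^2}-\frac1{l_-^2}\Big).$$ Let $y_1=\frac1{\sqrt N}\sum_i x_i$ and $y_k=\frac1{\sqrt{k(k-1)}}\big(x_1+\dots+x_{k-1}-(k-1)x_k\big)$ for $2\le k\le N$. With $H_\nu$ the physicists' Hermite polynomials, let $\varphi^{(l)}_\nu(y)=\pi^{-1/4}l^{-1/2}(2^\nu\nu!)^{-1/2}H_\nu(y/l)\,e^{-y^2/(2l^2)}$.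 For $n_-,n_+\in\mathbb{N}_0$ let $S_{n_-,n_+}$ be the span of the functions $\varphi^{(l_-)}_{\nu_1}(y_1)\prod_{k=2}^N\varphi^{(l_+)}_{\nu_k}(y_k)$ with $\nu_1=n_-$ and $\nu_2+\dots+\nu_N=n_+$; they are eigenfunctions of $H$ with energy $\hbar\omega_-(n_-+\tfrac12)+\hbar\omega_+(n_++\tfrac{N-1}2)$. Restrict $H$ to the antisymmetric functions in $L^2(\mathbb{R}^N)$. A ground state with energy $E$ of the restricted operator is a nonzero $\Psi$ in its domain with $H\Psi=E\Psi$ and $E\,\|\Phi\|^2\le\langle\Phi,H\Phi\rangle$ for all $\Phi$ in its domain. Then a ground state exists and is unique up to a nonzero complex factor. Its energy is $$E=\frac{\hbar\omega_-}{2}+\hbar\omega_+\Big(\frac{N(N-1)}2+\frac{N-1}2\Big).$$ It lies in $S_{n_-,n_+}$ for exactly one pair $(n_-,n_+)$, namely $n_-=0$, $n_+=N(N-1)/2$. With a suitable normalization constant $\mathcal N>0$ the normalized ground state is, up to a phase, $$\Psi_0(x)=\mathcal N\,\prod_{1\le i<j\le N}(x_i-x_j)\;e^{-A|x|^2+B_N(x_1+\dots+x_N)^2}.$$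 -/

import Mathlib

open MeasureTheory
open scoped SchwartzMap Laplacian

noncomputable section

namespace Harmonium

/-- The configuration space `ℝ^N` of `N` particles on the line. -/
abbrev Config (N : ℕ) : Type := EuclideanSpace ℝ (Fin N)

/-- The `N`-particle Hilbert space `L²(ℝ)^{⊗N} = L²(ℝ^N)`, complex valued, Lebesgue measure. -/
abbrev HilbertSpace (N : ℕ) : Type := Lp ℂ 2 (volume : Measure (Config N))

/-! ### Fermionic subspace -/

/-- The unitary representation of permutations: `(P Ψ)(x) = Ψ(x_{P 1}, …, x_{P N})`, i.e.
`P (φ₁ ⊗ ⋯ ⊗ φ_N) = φ_{P⁻¹ 1} ⊗ ⋯ ⊗ φ_{P⁻¹ N}`. -/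
def permOp (N : ℕ) (P : Equiv.Perm (Fin N)) : HilbertSpace N →ₗ[ℂ] HilbertSpace N :=
  Lp.compMeasurePreservingₗ ℂ (LinearIsometryEquiv.piLpCongrLeft 2 ℝ ℝ P.symm)
    (LinearIsometryEquiv.measurePreserving _)

/-- The subspace of antisymmetric `L²` functions: `P Ψ = sign(P) Ψ` for all permutations `P`. -/
def fermionSubspace (N : ℕ) : Submodule ℂ (HilbertSpace N) :=
  ⨅ P : Equiv.Perm (Fin N),
    LinearMap.ker (permOp N P - (((Equiv.Perm.sign P : ℤ) : ℂ)) • LinearMap.id)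

/-! ### The Hamiltonian -/

/-- The potential energy: a harmonic trap of frequency `ω` and a spring of constant `D` between the
particles of each pair. -/
def potential (N : ℕ) (m ω D : ℝ) (x : Config N) : ℝ :=
  ∑ i, (1 / 2) * m * ω ^ 2 * x i ^ 2 +
    (1 / 2) * D * ∑ i, ∑ j ∈ Finset.Ioi i, (x i - x j) ^ 2

theorem coord_hasTemperateGrowth (N : ℕ) (i : Fin N) :
    (fun x : Config N => x i).HasTemperateGrowth :=
  (EuclideanSpace.proj i : Config N →L[ℝ] ℝ).hasTemperateGrowth

/-- The potential is smooth of polynomial growth, so that multiplication by it is meaningful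
on tempered distributions. -/
theorem potential_hasTemperateGrowth (N : ℕ) (m ω D : ℝ) :
    (fun x : Config N => (potential N m ω D x : ℂ)).HasTemperateGrowth := by
  have h := coord_hasTemperateGrowth N
  have h2 : (fun x : Config N => potential N m ω D x).HasTemperateGrowth := by
    unfold potential
    fun_prop
  fun_prop

/-- The differential expression `∑ᵢ pᵢ² / (2m) + V`, with `pᵢ = -i ħ ∂ᵢ`, acting on tempered
distributions. -/
def formalHamiltonian (N : ℕ) (ħ m ω D : ℝ) : 𝓢'(Config N, ℂ) →ₗ[ℂ] 𝓢'(Config N, ℂ) :=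
  (-((ħ ^ 2 / (2 * m) : ℝ) : ℂ)) •
      (LineDeriv.laplacianCLM ℂ (Config N) 𝓢'(Config N, ℂ)).toLinearMap +
    (TemperedDistribution.smulLeftCLM ℂ
      (fun x : Config N => (potential N m ω D x : ℂ))).toLinearMap

/-- The inclusion of `L²(ℝ^N)` into the tempered distributions. -/
def toDistribution (N : ℕ) : HilbertSpace N →ₗ[ℂ] 𝓢'(Config N, ℂ) :=
  (Lp.toTemperedDistributionCLM ℂ (volume : Measure (Config N)) 2).toLinearMap

theorem toDistribution_injective (N : ℕ) : Function.Injective (toDistribution N) :=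
  LinearMap.ker_eq_bot.mp Lp.ker_toTemperedDistributionCLM_eq_bot

/-- The Hamiltonian as an unbounded operator on `L²(ℝ^N)`: its domain consists of the `Ψ ∈ L²` for
which `H Ψ`, computed in the sense of distributions, is again in `L²`. -/
def hamiltonian (N : ℕ) (ħ m ω D : ℝ) : HilbertSpace N →ₗ.[ℂ] HilbertSpace N where
  domain := (LinearMap.range (toDistribution N)).comap
    (formalHamiltonian N ħ m ω D ∘ₗ toDistribution N)
  toFun := (LinearEquiv.ofInjective (toDistribution N)
      (toDistribution_injective N)).symm.toLinearMap ∘ₗ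
    ((formalHamiltonian N ħ m ω D ∘ₗ toDistribution N).domRestrict
      ((LinearMap.range (toDistribution N)).comap
        (formalHamiltonian N ħ m ω D ∘ₗ toDistribution N))).codRestrict
      (LinearMap.range (toDistribution N)) (fun Ψ => Ψ.2)

theorem toDistribution_hamiltonian (N : ℕ) (ħ m ω D : ℝ) (Ψ : (hamiltonian N ħ m ω D).domain) :
    toDistribution N (hamiltonian N ħ m ω D Ψ) =
      formalHamiltonian N ħ m ω D (toDistribution N Ψ) :=
  congrArg Subtype.val ((LinearEquiv.ofInjective (toDistribution N)
    (toDistribution_injective N)).apply_symm_apply _)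

/-- The Hamiltonian restricted to antisymmetric functions. -/
def fermionHamiltonian (N : ℕ) (ħ m ω D : ℝ) : HilbertSpace N →ₗ.[ℂ] HilbertSpace N :=
  (hamiltonian N ħ m ω D).domRestrict (fermionSubspace N)

/-- `Ψ` is a ground state of the operator `A` with ground state energy `E`: it is an eigenvector
of `A` with eigenvalue `E`, and no vector in the domain of `A` has smaller mean energy. -/
def IsGroundState {V : Type*} [NormedAddCommGroup V] [InnerProductSpace ℂ V] (A : V →ₗ.[ℂ] V)
    (E : ℝ) (Ψ : V) : Prop :=
  Ψ ≠ 0 ∧ (∃ h : Ψ ∈ A.domain, A ⟨Ψ, h⟩ = (E : ℂ) • Ψ) ∧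
    ∀ Φ : A.domain, E * ‖(Φ : V)‖ ^ 2 ≤ (inner ℂ (Φ : V) (A Φ)).re

/-! ### Frequencies, length scales and energies -/

/-- The frequency `ω₋ = √(d₋ / m)`, `d₋ = m ω²`, of the centre of mass motion. -/
def freqMinus (m ω : ℝ) : ℝ := Real.sqrt (m * ω ^ 2 / m)

/-- The frequency `ω₊ = √(d₊ / m)`, `d₊ = m ω² + N D`, of the relative motion. -/
def freqPlus (N : ℕ) (m ω D : ℝ) : ℝ := Real.sqrt ((m * ω ^ 2 + N * D) / m)

/-- The length scale `l₋ = √(ħ / (m ω₋))`. -/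
def lengthMinus (ħ m ω : ℝ) : ℝ := Real.sqrt (ħ / (m * freqMinus m ω))

/-- The length scale `l₊ = √(ħ / (m ω₊))`. -/
def lengthPlus (N : ℕ) (ħ m ω D : ℝ) : ℝ := Real.sqrt (ħ / (m * freqPlus N m ω D))

/-- The energy with `nMinus` centre of mass excitations and `nPlus` relative excitations. -/
def energy (N : ℕ) (ħ m ω D : ℝ) (nMinus nPlus : ℕ) : ℝ :=
  ħ * freqMinus m ω * (nMinus + 1 / 2) + ħ * freqPlus N m ω D * (nPlus + ((N : ℝ) - 1) / 2)

/-! ### Hermite eigenfunctions and the spaces they span -/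

/-- The physicists' Hermite polynomial `H_n(x) = 2^{n/2} He_n(√2 x)`. -/
def physHermite (n : ℕ) (x : ℝ) : ℝ :=
  Real.sqrt 2 ^ n * Polynomial.aeval (Real.sqrt 2 * x) (Polynomial.hermite n)

/-- The `n`-th normalized Hermite function of length scale `l`. -/
def hermiteFun (n : ℕ) (l y : ℝ) : ℝ :=
  Real.pi ^ (-(1 / 4) : ℝ) * l ^ (-(1 / 2) : ℝ) *
    ((2 : ℝ) ^ n * (n.factorial : ℝ)) ^ (-(1 / 2) : ℝ) *
      physHermite n (y / l) * Real.exp (-(y ^ 2 / (2 * l ^ 2)))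

/-- The normal coordinates `y_k = ⟨e_k, x⟩` (with `k` counted from `0`): the centre of mass
coordinate `y_0 = (x_0 + ⋯ + x_{N-1}) / √N`, and the relative coordinates
`y_k = (x_0 + ⋯ + x_{k-1} - k x_k) / √(k (k + 1))` for `k ≥ 1`. -/
def normalCoord {N : ℕ} (x : Config N) (k : Fin N) : ℝ :=
  if (k : ℕ) = 0 then (∑ i, x i) / Real.sqrt N
  else (∑ i ∈ Finset.Iio k, x i - (k : ℕ) * x k) / Real.sqrt ((k : ℕ) * ((k : ℕ) + 1))

/-- The product Hermite function `φ_{ν_0}^{(l₋)}(y_0) ∏_{k ≥ 1} φ_{ν_k}^{(l₊)}(y_k)`. -/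
def productState (N : ℕ) (ħ m ω D : ℝ) (ν : Fin N → ℕ) (x : Config N) : ℝ :=
  ∏ k : Fin N, hermiteFun (ν k)
    (if (k : ℕ) = 0 then lengthMinus ħ m ω else lengthPlus N ħ m ω D) (normalCoord x k)

/-- The multi-indices with `ν_0 = nMinus` and `∑_{k ≥ 1} ν_k = nPlus`. -/
def excitationSet (N nMinus nPlus : ℕ) : Set (Fin N → ℕ) :=
  {ν | (∀ k : Fin N, (k : ℕ) = 0 → ν k = nMinus) ∧
    ∑ k ∈ Finset.univ.filter (fun k : Fin N => (k : ℕ) ≠ 0), ν k = nPlus}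

/-- The subspace `S_{n₋,n₊}` of `L²(ℝ^N)` spanned by the product Hermite functions with `n₋` centre
of mass excitations and `n₊` relative excitations. -/
def excitationSpace (N : ℕ) (ħ m ω D : ℝ) (nMinus nPlus : ℕ) : Submodule ℂ (HilbertSpace N) :=
  Submodule.span ℂ {Φ | ∃ ν ∈ excitationSet N nMinus nPlus,
    (Φ : Config N → ℂ) =ᵐ[volume] fun x => (productState N ħ m ω D ν x : ℂ)}

/-! ### The explicit wave function -/

/-- `A = 1 / (2 l₊²)`. -/
def coeffA (N : ℕ) (ħ m ω D : ℝ) : ℝ := 1 / (2 * lengthPlus N ħ m ω D ^ 2)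

/-- `B_N = (1 / l₊² - 1 / l₋²) / (2N)`. -/
def coeffB (N : ℕ) (ħ m ω D : ℝ) : ℝ :=
  1 / (2 * N) * (1 / lengthPlus N ħ m ω D ^ 2 - 1 / lengthMinus ħ m ω ^ 2)

/-- `∏_{i<j} (x_i - x_j) · exp (-A |x|² + B_N (x_1 + ⋯ + x_N)²)`. -/
def vandermondeGaussian (N : ℕ) (ħ m ω D : ℝ) (x : Config N) : ℝ :=
  (∏ i, ∏ j ∈ Finset.Ioi i, (x i - x j)) *
    Real.exp (-coeffA N ħ m ω D * ∑ i, x i ^ 2 + coeffB N ħ m ω D * (∑ i, x i) ^ 2)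

end Harmonium

end

/-! In normal coordinates the Hamiltonian is a sum of independent harmonic oscillators, one with
frequency `ω₋` for the centre of mass and `N - 1` with frequency `ω₊` for the relative motion, and
its eigenfunctions are the product Hermite functions. They form a Hilbert basis of `L²`
(`hermiteBasis`): orthogonality is Fubini and the one-dimensional integral, and completeness holds
because a function `Ψ` orthogonal to all polynomials times the Gaussian weight `w` makes the
Fourier transform of `w Ψ` vanish. As the product Hermite functions are Schwartz functions,
testing the distribution `H Ψ` against them gives `⟨f_ν, H Ψ⟩ = E_ν ⟨f_ν, Ψ⟩` for every `Ψ` in the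
domain (`inner_hermiteBasis_hamiltonian`), so that energies and eigenvectors can be read off from
Hermite coefficients, without any theorem on self-adjointness.

The Pauli principle enters through alternating polynomials: the exponents in such a polynomial are
distinct, whence its degree is at least `N (N - 1) / 2`, and in this degree it is unique up to a
factor (`IsAlternating.exists_eq_smul`). Pairing an antisymmetric `Ψ` with `f_ν` is pairing it
with the alternatization of `f_ν`, in which the Gaussian and the centre of mass factor, being
symmetric, can be pulled out. Therefore the coefficients with fewer than `N (N - 1) / 2` relative
excitations vanish (`inner_hermiteBasis_eq_zero`), and those with exactly `N (N - 1) / 2` relative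
and no centre of mass excitation are fixed multiples of the overlap of `Ψ` with the Vandermonde
state (`exists_inner_hermiteBasis_eq`). The first fact gives the lower bound on the energy
(`energy_mul_norm_sq_le`), both together give uniqueness (`exists_eq_smul_of_eigenvector`). The
Vandermonde state itself is a polynomial of degree `N (N - 1) / 2` times the Gaussian and is
antisymmetric; this leaves only the Hermite functions of the lowest admissible energy in its
expansion (`polyState_vandermonde_mem_excitationSpace`), so it is an eigenvector and no derivative
of the Vandermonde product has to be computed. -/

noncomputable section

namespace Harmonium

/-! ### Hermite polynomials and alternating polynomials -/

theorem derivative_hermite_succ (n : ℕ) :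
    Polynomial.derivative (Polynomial.hermite (n + 1)) =
      ((n : Polynomial ℤ) + 1) * Polynomial.hermite n := by
  induction n with
  | zero => simp
  | succ n ih =>
    rw [Polynomial.hermite_succ (n + 1), Polynomial.derivative_sub, ih, Polynomial.derivative_mul,
      ih, Polynomial.derivative_mul, Polynomial.hermite_succ n]
    simp
    ring

theorem derivative_derivative_hermite (n : ℕ) :
    Polynomial.derivative (Polynomial.derivative (Polynomial.hermite n)) =
      Polynomial.X * Polynomial.derivative (Polynomial.hermite n) -
        (n : Polynomial ℤ) * Polynomial.hermite n := by
  cases n with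
  | zero => simp
  | succ n =>
    rw [derivative_hermite_succ, Polynomial.derivative_mul, Polynomial.hermite_succ n]
    simp
    ring

/-- `N` distinct natural numbers sum to at least `0 + 1 + ⋯ + (N - 1)`, and equality forces them
to be `0, …, N - 1` in some order: exchanging the values `≥ N` for the missing ones `< N` lowers
the sum. -/
theorem sum_le_and_lt_of_injective {N : ℕ} (m : Fin N → ℕ) (hm : Function.Injective m) :
    N * (N - 1) / 2 ≤ ∑ i, m i ∧ (∑ i, m i ≤ N * (N - 1) / 2 → ∀ i, m i < N) := by
  classical
  set S := Finset.univ.image m with hS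
  have hc : S.card = (Finset.range N).card := by
    rw [hS, Finset.card_image_of_injective _ hm]; simp
  have hsum : ∑ i, m i = ∑ a ∈ S, a := by
    rw [hS, Finset.sum_image (fun a _ b _ h => hm h)]
  have h1 : (S \ Finset.range N).card = (Finset.range N \ S).card :=
    Finset.card_sdiff_comm hc
  have h2 := Finset.sum_inter_add_sum_sdiff S (Finset.range N) (fun a : ℕ => a)
  have h3 := Finset.sum_inter_add_sum_sdiff (Finset.range N) S (fun a : ℕ => a)
  rw [Finset.inter_comm, Finset.sum_range_id] at h3
  -- The elements of `S` outside `range N` are at least `N`; as many elements of `range N` are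
  -- missing from `S`.
  have h4 : (S \ Finset.range N).card * N ≤ ∑ a ∈ S \ Finset.range N, a := by
    rw [← smul_eq_mul]
    exact Finset.card_nsmul_le_sum _ _ _ (fun a ha => by simpa using (Finset.mem_sdiff.1 ha).2)
  have h5 : ∑ a ∈ Finset.range N \ S, (a + 1) ≤ (Finset.range N \ S).card * N := by
    rw [← smul_eq_mul]
    refine Finset.sum_le_card_nsmul _ _ _ (fun a ha => ?_)
    have := (Finset.mem_sdiff.1 ha).1
    simp at this
    omega
  rw [Finset.sum_add_distrib, Finset.sum_const, smul_eq_mul, mul_one, ← h1] at h5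
  refine ⟨by omega, fun h i => ?_⟩
  have h6 : (S \ Finset.range N).card = 0 := by omega
  rw [Finset.card_eq_zero, Finset.sdiff_eq_empty_iff_subset] at h6
  simpa using h6 (Finset.mem_image_of_mem m (Finset.mem_univ i))

/-- A polynomial is alternating if a permutation of its variables multiplies it by the sign. -/
def IsAlternating {N : ℕ} (p : MvPolynomial (Fin N) ℝ) : Prop :=
  ∀ P : Equiv.Perm (Fin N), MvPolynomial.rename P p = (Equiv.Perm.sign P : ℤ) • p

theorem IsAlternating.coeff_mapDomain {N : ℕ} {p : MvPolynomial (Fin N) ℝ} (hp : IsAlternating p)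
    (P : Equiv.Perm (Fin N)) (d : Fin N →₀ ℕ) :
    (Equiv.Perm.sign P : ℤ) • p.coeff (d.mapDomain P) = p.coeff d := by
  rw [← MvPolynomial.coeff_rename_mapDomain P P.injective p d, hp P, MvPolynomial.coeff_smul]

/-- The exponents of a monomial in an alternating polynomial are distinct: swapping two equal ones
fixes the monomial but changes the sign of its coefficient. -/
theorem IsAlternating.injective_of_coeff_ne_zero {N : ℕ} {p : MvPolynomial (Fin N) ℝ}
    (hp : IsAlternating p) {d : Fin N →₀ ℕ} (hd : p.coeff d ≠ 0) : Function.Injective d := by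
  intro i j hij
  by_contra hne
  have h := hp.coeff_mapDomain (Equiv.swap i j) d
  -- The swap of `i` and `j` fixes the monomial.
  have h2 : d.mapDomain (Equiv.swap i j) = d := by
    ext k
    rw [Finsupp.mapDomain_equiv_apply, Equiv.symm_swap, Equiv.swap_apply_def]
    split_ifs with h1 h2 <;> simp [*]
  rw [h2, Equiv.Perm.sign_swap hne] at h
  simp at h
  exact hd (by linarith)

theorem IsAlternating.eq_zero_of_totalDegree_lt {N : ℕ} {p : MvPolynomial (Fin N) ℝ}
    (hp : IsAlternating p) (hdeg : p.totalDegree < N * (N - 1) / 2) : p = 0 := by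
  by_contra h
  obtain ⟨d, hd⟩ := MvPolynomial.ne_zero_iff.1 h
  have h1 := (sum_le_and_lt_of_injective d (hp.injective_of_coeff_ne_zero hd)).1
  have h2 := MvPolynomial.le_totalDegree (MvPolynomial.mem_support_iff.2 hd)
  rw [Finsupp.sum_fintype _ _ (fun _ => rfl)] at h2
  omega

/-- The exponents `(0, 1, …, N - 1)`, the only ones, up to permutation, in an alternating polynomial
of lowest degree. -/
def staircase (N : ℕ) : Fin N →₀ ℕ := Finsupp.equivFunOnFinite.symm (fun i => (i : ℕ))

/-- In degree at most `N (N - 1) / 2` every exponent of an alternating polynomial is a permutation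
of the staircase, so that one coefficient determines all of them. -/
theorem IsAlternating.eq_zero_of_coeff_staircase {N : ℕ} {p : MvPolynomial (Fin N) ℝ}
    (hp : IsAlternating p) (hdeg : p.totalDegree ≤ N * (N - 1) / 2)
    (h0 : p.coeff (staircase N) = 0) : p = 0 := by
  by_contra h
  obtain ⟨d, hd⟩ := MvPolynomial.ne_zero_iff.1 h
  have hinj := hp.injective_of_coeff_ne_zero hd
  have h2 := MvPolynomial.le_totalDegree (MvPolynomial.mem_support_iff.2 hd)
  rw [Finsupp.sum_fintype _ _ (fun _ => rfl)] at h2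
  have hlt := (sum_le_and_lt_of_injective d hinj).2 (h2.trans hdeg)
  let P : Equiv.Perm (Fin N) := Equiv.ofBijective (fun i => (⟨d i, hlt i⟩ : Fin N))
    (Finite.injective_iff_bijective.1 fun i j hij => hinj (by simpa using hij))
  have h3 := hp.coeff_mapDomain P d
  have h4 : d.mapDomain P = staircase N := by
    ext k
    obtain ⟨i, rfl⟩ := P.surjective k
    rw [Finsupp.mapDomain_equiv_apply, Equiv.symm_apply_apply]
    rfl
  rw [h4, h0, smul_zero] at h3
  exact hd h3.symm

/-- Alternating polynomials of the lowest possible degree are proportional to each other. -/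
theorem IsAlternating.exists_eq_smul {N : ℕ} {p q : MvPolynomial (Fin N) ℝ}
    (hp : IsAlternating p) (hq : IsAlternating q) (hpd : p.totalDegree ≤ N * (N - 1) / 2)
    (hqd : q.totalDegree ≤ N * (N - 1) / 2) (hq0 : q ≠ 0) : ∃ c : ℝ, p = c • q := by
  have hc : q.coeff (staircase N) ≠ 0 := fun h => hq0 (hq.eq_zero_of_coeff_staircase hqd h)
  refine ⟨p.coeff (staircase N) / q.coeff (staircase N), sub_eq_zero.1 ?_⟩
  refine IsAlternating.eq_zero_of_coeff_staircase (fun P => ?_) ?_ ?_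
  · rw [map_sub, map_smul, hp P, hq P, smul_sub, smul_comm]
  · exact (MvPolynomial.totalDegree_sub _ _).trans
      (max_le hpd ((MvPolynomial.totalDegree_smul_le _ _).trans hqd))
  · simp [hc]

/-- The alternating sum of the polynomials obtained from `p` by permuting the variables. -/
def alternatization {N : ℕ} : MvPolynomial (Fin N) ℝ →ₗ[ℝ] MvPolynomial (Fin N) ℝ :=
  ∑ P : Equiv.Perm (Fin N), (Equiv.Perm.sign P : ℤ) • (MvPolynomial.rename P).toLinearMap

theorem alternatization_apply {N : ℕ} (p : MvPolynomial (Fin N) ℝ) :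
    alternatization p = ∑ P : Equiv.Perm (Fin N),
      (Equiv.Perm.sign P : ℤ) • MvPolynomial.rename P p := by
  simp [alternatization, LinearMap.sum_apply]

theorem isAlternating_alternatization {N : ℕ} (p : MvPolynomial (Fin N) ℝ) :
    IsAlternating (alternatization p) := by
  intro P
  rw [alternatization_apply, map_sum, Finset.smul_sum]
  refine Fintype.sum_equiv (Equiv.mulLeft P) _ _ (fun Q => ?_)
  have h : (Equiv.Perm.sign P : ℤ) * (Equiv.Perm.sign P : ℤ) = 1 := by
    rw [← Units.val_mul, Int.units_mul_self]; rfl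
  rw [map_zsmul, MvPolynomial.rename_rename, Equiv.coe_mulLeft, map_mul, Units.val_mul, smul_smul,
    ← mul_assoc, h, one_mul]
  rfl

theorem totalDegree_alternatization_le {N : ℕ} (p : MvPolynomial (Fin N) ℝ) :
    (alternatization p).totalDegree ≤ p.totalDegree := by
  rw [alternatization_apply]
  refine MvPolynomial.totalDegree_finsetSum_le (fun P _ => ?_)
  rw [← Int.cast_smul_eq_zsmul ℝ]
  exact (MvPolynomial.totalDegree_smul_le _ _).trans (MvPolynomial.totalDegree_rename_le _ _)

theorem alternatization_mul_of_symmetric {N : ℕ} {r : MvPolynomial (Fin N) ℝ}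
    (hr : r.IsSymmetric) (p : MvPolynomial (Fin N) ℝ) :
    alternatization (r * p) = r * alternatization p := by
  rw [alternatization_apply, alternatization_apply, Finset.mul_sum]
  refine Finset.sum_congr rfl (fun P _ => ?_)
  rw [map_mul, hr P, mul_smul_comm]

/-- The Vandermonde polynomial `∏_{i<j} (X_i - X_j)`. -/
def vandermondePoly (N : ℕ) : MvPolynomial (Fin N) ℝ :=
  ∏ i, ∏ j ∈ Finset.Ioi i, (MvPolynomial.X i - MvPolynomial.X j)

theorem vandermondePoly_ne_zero (N : ℕ) : vandermondePoly N ≠ 0 := by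
  refine Finset.prod_ne_zero_iff.2 (fun i _ => Finset.prod_ne_zero_iff.2 (fun j hj => ?_))
  rw [sub_ne_zero]
  exact fun h => (Finset.mem_Ioi.1 hj).ne (MvPolynomial.X_injective h)

theorem sum_card_Ioi (N : ℕ) : ∑ i : Fin N, (Finset.Ioi i).card = N * (N - 1) / 2 := by
  simp only [Fin.card_Ioi]
  rw [← Finset.sum_range_id, ← Finset.sum_range_reflect, Finset.sum_range]

theorem totalDegree_vandermondePoly_le (N : ℕ) :
    (vandermondePoly N).totalDegree ≤ N * (N - 1) / 2 := by
  rw [← sum_card_Ioi]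
  refine (MvPolynomial.totalDegree_finsetProd _ _).trans (Finset.sum_le_sum fun i _ => ?_)
  refine (MvPolynomial.totalDegree_finsetProd _ _).trans ?_
  rw [Finset.card_eq_sum_ones]
  refine Finset.sum_le_sum fun j _ => (MvPolynomial.totalDegree_sub _ _).trans ?_
  simp [MvPolynomial.totalDegree_X]

theorem isAlternating_vandermondePoly (N : ℕ) : IsAlternating (vandermondePoly N) := by
  have key : vandermondePoly N = (Matrix.vandermonde
      (fun i => -(MvPolynomial.X i : MvPolynomial (Fin N) ℝ))).det := by
    rw [Matrix.det_vandermonde, vandermondePoly]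
    refine Finset.prod_congr rfl fun i _ => Finset.prod_congr rfl fun j _ => by ring
  intro P
  rw [key, AlgHom.map_det]
  have : (MvPolynomial.rename P).mapMatrix (Matrix.vandermonde
      (fun i => -(MvPolynomial.X i : MvPolynomial (Fin N) ℝ))) = (Matrix.vandermonde
      (fun i => -(MvPolynomial.X i : MvPolynomial (Fin N) ℝ))).submatrix P id := by
    ext1 i j
    simp [Matrix.vandermonde_apply]
  rw [this, Matrix.det_permute, zsmul_eq_mul]

/-! ### Hermite functions in one variable -/

theorem integrable_polynomial_mul_exp_neg_sq (p : Polynomial ℝ) :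
    Integrable (fun x : ℝ => p.eval x * Real.exp (-(x ^ 2 / 2))) := by
  induction p using Polynomial.induction_on' with
  | add p q hp hq =>
    simp only [Polynomial.eval_add, add_mul]
    exact hp.add hq
  | monomial n a =>
    have h := (integrable_rpow_mul_exp_neg_mul_sq (b := 1 / 2) (by norm_num) (s := n)
      (by have : (0 : ℝ) ≤ n := n.cast_nonneg
          linarith)).const_mul a
    refine h.congr (Filter.Eventually.of_forall fun x => ?_)
    simp only [Polynomial.eval_monomial, Real.rpow_natCast]
    rw [mul_assoc]
    congr 3
    ring

theorem hasDerivAt_exp_neg_sq (x : ℝ) :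
    HasDerivAt (fun x : ℝ => Real.exp (-(x ^ 2 / 2))) (-x * Real.exp (-(x ^ 2 / 2))) x := by
  have h := ((((hasDerivAt_id x).pow 2).div_const 2).neg).exp
  convert! h using 1
  simp
  ring

/-- Integration by parts against the Gaussian weight: raising the Hermite index is adjoint to
differentiation. -/
theorem integral_hermite_succ_mul (n : ℕ) (p : Polynomial ℤ) :
    ∫ x : ℝ, Polynomial.aeval x (Polynomial.hermite (n + 1) * p) * Real.exp (-(x ^ 2 / 2)) =
      ∫ x : ℝ, Polynomial.aeval x (Polynomial.hermite n * Polynomial.derivative p) *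
        Real.exp (-(x ^ 2 / 2)) := by
  have hint : ∀ q : Polynomial ℤ,
      Integrable (fun x : ℝ => Polynomial.aeval x q * Real.exp (-(x ^ 2 / 2))) := fun q => by
    have := integrable_polynomial_mul_exp_neg_sq (q.map (Int.castRingHom ℝ))
    simpa only [Polynomial.eval_map, Polynomial.aeval_def, algebraMap_int_eq] using this
  rw [← sub_eq_zero, ← integral_sub (hint _) (hint _)]
  refine integral_eq_zero_of_hasDerivAt_of_integrable (f := fun x : ℝ =>
    -(Polynomial.aeval x (Polynomial.hermite n * p) * Real.exp (-(x ^ 2 / 2)))) (fun x => ?_)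
    ((hint _).sub (hint _)) (hint _).neg
  convert! (((Polynomial.hermite n * p).hasDerivAt_aeval x).mul (hasDerivAt_exp_neg_sq x)).neg
    using 1
  simp only [Polynomial.hermite_succ, Polynomial.derivative_mul, map_mul, map_sub, map_add,
    Polynomial.aeval_X]
  ring

/-- Orthogonality of the Hermite polynomials: moving one Hermite index into a derivative lowers both
indices by one. -/
theorem integral_hermite_mul_hermite (n k : ℕ) :
    ∫ x : ℝ, Polynomial.aeval x (Polynomial.hermite n * Polynomial.hermite k) *
      Real.exp (-(x ^ 2 / 2)) = if n = k then n.factorial * Real.sqrt (2 * Real.pi) else 0 := by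
  induction n generalizing k with
  | zero =>
    cases k with
    | zero =>
      have := integral_gaussian (1 / 2)
      simp only [Polynomial.hermite_zero, map_one, mul_one, one_mul, if_true, Nat.factorial_zero,
        Nat.cast_one]
      convert! this using 2
      · ext x; congr 1; ring
      · rw [div_div_eq_mul_div, div_one, mul_comm]
    | succ k =>
      rw [mul_comm, integral_hermite_succ_mul]
      simp
  | succ n ih =>
    rw [integral_hermite_succ_mul]
    cases k with
    | zero => simp
    | succ k =>
      rw [derivative_hermite_succ]
      have : ∀ x : ℝ, Polynomial.aeval x (Polynomial.hermite n *
          (((k : Polynomial ℤ) + 1) * Polynomial.hermite k)) * Real.exp (-(x ^ 2 / 2)) =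
          ((k : ℝ) + 1) * (Polynomial.aeval x (Polynomial.hermite n * Polynomial.hermite k) *
            Real.exp (-(x ^ 2 / 2))) := fun x => by
        simp; ring
      simp_rw [this]
      rw [integral_const_mul, ih]
      by_cases h : n = k
      · subst h; simp [Nat.factorial_succ]; ring
      · simp [h]

/-- The normalization constant of the Hermite function. -/
def hermiteNorm (n : ℕ) (l : ℝ) : ℝ :=
  Real.pi ^ (-(1 / 4) : ℝ) * l ^ (-(1 / 2) : ℝ) *
    ((2 : ℝ) ^ n * (n.factorial : ℝ)) ^ (-(1 / 2) : ℝ) * Real.sqrt 2 ^ n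

theorem hermiteNorm_pos (n : ℕ) {l : ℝ} (hl : 0 < l) : 0 < hermiteNorm n l := by
  unfold hermiteNorm
  have := Real.pi_pos
  positivity

theorem hermiteFun_eq (n : ℕ) (l y : ℝ) : hermiteFun n l y =
    hermiteNorm n l * (Polynomial.aeval (Real.sqrt 2 / l * y) (Polynomial.hermite n) *
      Real.exp (-(y ^ 2 / (2 * l ^ 2)))) := by
  unfold hermiteFun hermiteNorm physHermite
  rw [show Real.sqrt 2 * (y / l) = Real.sqrt 2 / l * y by ring]
  ring

theorem hermiteNorm_sq (n : ℕ) {l : ℝ} (hl : 0 < l) :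
    hermiteNorm n l ^ 2 * (n.factorial * Real.sqrt (2 * Real.pi)) = Real.sqrt 2 / l := by
  have hpi := Real.pi_pos
  have h : ∀ x : ℝ, 0 < x → (x ^ (-(1 / 2) : ℝ)) ^ 2 = x⁻¹ := fun x hx => by
    rw [← Real.rpow_natCast, ← Real.rpow_mul hx.le]
    norm_num
    exact Real.rpow_neg_one x
  have h4 : (Real.pi ^ (-(1 / 4) : ℝ)) ^ 2 = (Real.sqrt Real.pi)⁻¹ := by
    rw [← Real.rpow_natCast, ← Real.rpow_mul hpi.le, Real.sqrt_eq_rpow, ← Real.rpow_neg hpi.le]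
    norm_num
  unfold hermiteNorm
  rw [mul_pow, mul_pow, mul_pow, h l hl, h _ (by positivity), h4, ← pow_mul, mul_comm n 2, pow_mul,
    Real.sq_sqrt (by norm_num), Real.sqrt_mul (by norm_num)]
  field_simp

theorem integral_hermiteFun_mul (n k : ℕ) {l : ℝ} (hl : 0 < l) :
    ∫ y : ℝ, hermiteFun n l y * hermiteFun k l y = if n = k then 1 else 0 := by
  have h2 : (0 : ℝ) < Real.sqrt 2 := by positivity
  have : ∀ y : ℝ, hermiteFun n l y * hermiteFun k l y = hermiteNorm n l * hermiteNorm k l *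
      (fun x : ℝ => Polynomial.aeval x (Polynomial.hermite n * Polynomial.hermite k) *
        Real.exp (-(x ^ 2 / 2))) (Real.sqrt 2 / l * y) := fun y => by
    have he : Real.exp (-(y ^ 2 / (2 * l ^ 2))) * Real.exp (-(y ^ 2 / (2 * l ^ 2))) =
        Real.exp (-((Real.sqrt 2 / l * y) ^ 2 / 2)) := by
      rw [← Real.exp_add, mul_pow, div_pow, Real.sq_sqrt (by norm_num)]
      congr 1
      field_simp
      ring
    rw [hermiteFun_eq, hermiteFun_eq]
    simp only [map_mul]
    rw [← he]
    ring
  simp_rw [this]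
  rw [integral_const_mul, Measure.integral_comp_mul_left (fun x : ℝ => Polynomial.aeval x
    (Polynomial.hermite n * Polynomial.hermite k) * Real.exp (-(x ^ 2 / 2))),
    integral_hermite_mul_hermite]
  by_cases hnk : n = k
  · subst hnk
    rw [if_pos rfl, if_pos rfl, abs_of_pos (by positivity), smul_eq_mul, mul_left_comm, ← sq,
      hermiteNorm_sq n hl]
    exact inv_mul_cancel₀ (by positivity)
  · simp [hnk]

theorem hasDerivAt_polynomial_mul_exp (p : Polynomial ℤ) (c l y : ℝ) :
    HasDerivAt (fun y : ℝ => Polynomial.aeval (c * y) p * Real.exp (-(y ^ 2 / (2 * l ^ 2))))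
      (c * (Polynomial.aeval (c * y) (Polynomial.derivative p) *
        Real.exp (-(y ^ 2 / (2 * l ^ 2)))) -
        y / l ^ 2 * (Polynomial.aeval (c * y) p * Real.exp (-(y ^ 2 / (2 * l ^ 2))))) y := by
  have h1 : HasDerivAt (fun y : ℝ => Polynomial.aeval (c * y) p)
      (Polynomial.aeval (c * y) (Polynomial.derivative p) * c) y := by
    have h := HasDerivAt.comp y (p.hasDerivAt_aeval (c * y)) ((hasDerivAt_id y).const_mul c)
    simpa [Function.comp_def] using h
  have h2 := ((((hasDerivAt_id y).pow 2).div_const (2 * l ^ 2)).neg).exp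
  convert! h1.mul h2 using 1
  simp only [id_eq, Pi.pow_apply, Pi.neg_apply]
  by_cases hl : l = 0
  · subst hl; simp; ring
  · field_simp
    push_cast
    ring

theorem differentiable_hermiteFun (n : ℕ) (l : ℝ) : Differentiable ℝ (hermiteFun n l) := by
  have : hermiteFun n l = fun y => hermiteNorm n l * (Polynomial.aeval (Real.sqrt 2 / l * y)
      (Polynomial.hermite n) * Real.exp (-(y ^ 2 / (2 * l ^ 2)))) := funext (hermiteFun_eq n l)
  rw [this]
  exact fun y => ((hasDerivAt_polynomial_mul_exp _ _ l y).const_mul _).differentiableAt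

/-- The Hermite functions solve the one-dimensional harmonic oscillator equation. -/
theorem hasDerivAt_deriv_hermiteFun (n : ℕ) {l : ℝ} (hl : 0 < l) (y : ℝ) :
    HasDerivAt (deriv (hermiteFun n l))
      ((y ^ 2 / l ^ 4 - (2 * n + 1) / l ^ 2) * hermiteFun n l y) y := by
  set c := Real.sqrt 2 / l with hc
  have hc2 : c ^ 2 = 2 / l ^ 2 := by rw [hc, div_pow, Real.sq_sqrt (by norm_num)]
  have h1 : deriv (hermiteFun n l) = fun y => hermiteNorm n l *
      (c * (Polynomial.aeval (c * y) (Polynomial.derivative (Polynomial.hermite n)) *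
        Real.exp (-(y ^ 2 / (2 * l ^ 2)))) -
        y / l ^ 2 * (Polynomial.aeval (c * y) (Polynomial.hermite n) *
          Real.exp (-(y ^ 2 / (2 * l ^ 2))))) := by
    rw [show hermiteFun n l = fun y => hermiteNorm n l * (Polynomial.aeval (c * y)
      (Polynomial.hermite n) * Real.exp (-(y ^ 2 / (2 * l ^ 2)))) from funext (hermiteFun_eq n l)]
    exact funext fun y => ((hasDerivAt_polynomial_mul_exp _ _ l y).const_mul _).deriv
  rw [h1]
  have h2 := hasDerivAt_polynomial_mul_exp (Polynomial.derivative (Polynomial.hermite n)) c l y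
  have h3 := hasDerivAt_polynomial_mul_exp (Polynomial.hermite n) c l y
  have h4 := (((h2.const_mul c).sub (((hasDerivAt_id y).div_const (l ^ 2)).mul h3))).const_mul
    (hermiteNorm n l)
  convert! h4 using 1
  rw [derivative_derivative_hermite, hermiteFun_eq, ← hc]
  simp only [map_sub, map_mul, Polynomial.aeval_X, map_natCast, id_eq]
  generalize (Polynomial.aeval (c * y)) (Polynomial.derivative (Polynomial.hermite n)) = D
  generalize (Polynomial.aeval (c * y)) (Polynomial.hermite n) = H
  generalize Real.exp (-(y ^ 2 / (2 * l ^ 2))) = e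
  have : c * (c * (((c * y * D - n * H) * e)) - y / l ^ 2 * (D * e)) =
      c ^ 2 * (c * y * D - n * H) * e - c * (y / l ^ 2 * (D * e)) := by ring
  rw [this, hc2]
  field_simp
  ring

/-! ### Gaussians as Schwartz functions -/

/-- A Gaussian decays faster than any power, as `t ^ k ≤ k! exp t` for `t = c (1 + r ^ 2)`. -/
theorem exists_one_add_pow_mul_exp_neg_le {c : ℝ} (hc : 0 < c) (k : ℕ) :
    ∃ M : ℝ, ∀ r : ℝ, 0 ≤ r → (1 + r) ^ k * Real.exp (-(c * r ^ 2)) ≤ M := by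
  refine ⟨(2 / c) ^ k * (k.factorial * Real.exp c), fun r hr => ?_⟩
  have h1 : (1 + r) ^ k ≤ ((2 / c) * (c * (1 + r ^ 2))) ^ k := by
    refine pow_le_pow_left₀ (by positivity) ?_ k
    rw [div_mul_eq_mul_div, le_div_iff₀ hc]
    nlinarith [sq_nonneg (r - 1), mul_nonneg hc.le (sq_nonneg (r - 1)), mul_nonneg hc.le hr,
      mul_nonneg hc.le (sq_nonneg r)]
  have h2 := Real.pow_div_factorial_le_exp (c * (1 + r ^ 2)) (by positivity) k
  rw [div_le_iff₀ (by positivity)] at h2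
  calc (1 + r) ^ k * Real.exp (-(c * r ^ 2))
      ≤ ((2 / c) ^ k * (Real.exp (c * (1 + r ^ 2)) * k.factorial)) * Real.exp (-(c * r ^ 2)) := by
        rw [mul_pow] at h1
        gcongr
        exact h1.trans (by gcongr)
    _ = (2 / c) ^ k * (k.factorial * (Real.exp (c * (1 + r ^ 2)) * Real.exp (-(c * r ^ 2)))) := by
        ring
    _ = _ := by rw [← Real.exp_add]; congr 4; ring

/-- If `f` is smooth with derivatives of polynomial growth and `f` grows at least quadratically,
then `exp (-f)` is a Schwartz function. -/
def expNegSchwartz {E : Type*} [NormedAddCommGroup E] [NormedSpace ℝ E] (f : E → ℝ)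
    (hf : f.HasTemperateGrowth) (h : ∃ c > 0, ∃ C, ∀ x, c * ‖x‖ ^ 2 - C ≤ f x) :
    𝓢(E, ℝ) where
  toFun x := Real.exp (-f x)
  smooth' := Real.contDiff_exp.comp hf.1.neg
  decay' k n := by
    obtain ⟨c, hc, C, hC⟩ := h
    obtain ⟨m, A, hA, hbound⟩ := hf.neg.norm_iteratedFDeriv_le_uniform n
    obtain ⟨M, hM⟩ := exists_one_add_pow_mul_exp_neg_le hc (k + m * n)
    refine ⟨n.factorial * (A + 1) ^ n * Real.exp C * M, fun x => ?_⟩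
    have h1 : ∀ i, i ≤ n → ‖iteratedFDeriv ℝ i Real.exp ((-f) x)‖ ≤ Real.exp (-f x) := by
      intro i _
      rw [norm_iteratedFDeriv_eq_norm_iteratedDeriv, iteratedDeriv_eq_iterate, Real.iter_deriv_exp]
      simp
    have h2 : ∀ i, 1 ≤ i → i ≤ n →
        ‖iteratedFDeriv ℝ i (-f) x‖ ≤ ((A + 1) * (1 + ‖x‖) ^ m) ^ i := by
      intro i hi hin
      -- The bound is at least `1`, so that it may be raised to the power `i`.
      have h3 : (1 : ℝ) ≤ (A + 1) * (1 + ‖x‖) ^ m :=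
        one_le_mul_of_one_le_of_one_le (by linarith)
          (one_le_pow₀ (by linarith [norm_nonneg x]))
      calc _ ≤ A * (1 + ‖x‖) ^ m := hbound i hin x
        _ ≤ (A + 1) * (1 + ‖x‖) ^ m := by gcongr; linarith
        _ ≤ _ := le_self_pow₀ h3 (by omega)
    -- The Faà di Bruno bound for the derivatives of `exp ∘ (-f)`.
    have h4 := norm_iteratedFDeriv_comp_le (n := n) Real.contDiff_exp hf.neg.1
      (by exact_mod_cast le_top) x h1 h2
    have h5 : ‖x‖ ^ k ≤ (1 + ‖x‖) ^ k :=
      pow_le_pow_left₀ (norm_nonneg x) (by linarith) k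
    have h6 : Real.exp (-f x) ≤ Real.exp C * Real.exp (-(c * ‖x‖ ^ 2)) := by
      rw [← Real.exp_add]
      exact Real.exp_le_exp.2 (by linarith [hC x])
    change ‖x‖ ^ k * ‖iteratedFDeriv ℝ n (Real.exp ∘ (-f)) x‖ ≤ _
    calc _ ≤ (1 + ‖x‖) ^ k * (n.factorial * (Real.exp C * Real.exp (-(c * ‖x‖ ^ 2))) *
          ((A + 1) * (1 + ‖x‖) ^ m) ^ n) := by
          gcongr
          exact h4.trans (by gcongr)
      _ = n.factorial * (A + 1) ^ n * Real.exp C *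
          ((1 + ‖x‖) ^ (k + m * n) * Real.exp (-(c * ‖x‖ ^ 2))) := by
          rw [mul_pow, ← pow_mul, pow_add]; ring
      _ ≤ _ := by gcongr; exact hM _ (norm_nonneg x)

/-! ### Polynomials times a Gaussian -/

/-- The linear form `x ↦ ⟨a, x⟩` as a polynomial. -/
def linPoly {N : ℕ} : Config N →ₗ[ℝ] MvPolynomial (Fin N) ℝ where
  toFun a := ∑ i, a i • MvPolynomial.X i
  map_add' a b := by simp [add_smul, Finset.sum_add_distrib]
  map_smul' c a := by simp [mul_smul, Finset.smul_sum]

theorem eval_linPoly {N : ℕ} (a x : Config N) :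
    MvPolynomial.eval x.ofLp (linPoly a) = inner ℝ a x := by
  simp [linPoly, PiLp.inner_apply, mul_comm]

theorem totalDegree_linPoly_le {N : ℕ} (a : Config N) : (linPoly a).totalDegree ≤ 1 := by
  refine MvPolynomial.totalDegree_finsetSum_le fun i _ => ?_
  exact (MvPolynomial.totalDegree_smul_le _ _).trans (MvPolynomial.totalDegree_X _).le

theorem eval_hasTemperateGrowth {N : ℕ} (p : MvPolynomial (Fin N) ℝ) :
    (fun x : Config N => (MvPolynomial.eval x.ofLp p : ℂ)).HasTemperateGrowth := by
  have h : (fun x : Config N => MvPolynomial.eval x.ofLp p).HasTemperateGrowth := by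
    induction p using MvPolynomial.induction_on with
    | C a => simp
    | add p q hp hq =>
      simp only [map_add]
      exact hp.add hq
    | mul_X p i hp =>
      simp only [map_mul, MvPolynomial.eval_X]
      exact hp.mul (coord_hasTemperateGrowth N i)
  fun_prop

/-- The exponent `∑ₖ ⟨bₖ, x⟩² / (2 lₖ²)` of the Gaussian with length scale `lₖ` in direction
`bₖ`. -/
def gaussExponent {N : ℕ} (b : OrthonormalBasis (Fin N) ℝ (Config N)) (l : Fin N → ℝ)
    (x : Config N) : ℝ :=
  ∑ k, inner ℝ (b k) x ^ 2 / (2 * l k ^ 2)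

theorem hasTemperateGrowth_gaussExponent {N : ℕ} (b : OrthonormalBasis (Fin N) ℝ (Config N))
    (l : Fin N → ℝ) : (gaussExponent b l).HasTemperateGrowth := by
  unfold gaussExponent
  have h : ∀ k, (fun x => inner ℝ (b k) x).HasTemperateGrowth :=
    fun k => Function.hasTemperateGrowth_inner_right (b k)
  simp only [div_eq_mul_inv]
  fun_prop

theorem exists_mul_norm_sq_le_gaussExponent {N : ℕ} (b : OrthonormalBasis (Fin N) ℝ (Config N))
    {l : Fin N → ℝ} (hl : ∀ k, 0 < l k) :
    ∃ c > 0, ∀ x, c * ‖x‖ ^ 2 ≤ gaussExponent b l x := by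
  refine ⟨1 / (2 * ∑ k, l k ^ 2 + 1), by positivity, fun x => ?_⟩
  rw [← b.sum_sq_norm_inner_right x, Finset.mul_sum]
  refine Finset.sum_le_sum fun k _ => ?_
  have h : l k ^ 2 ≤ ∑ k, l k ^ 2 :=
    Finset.single_le_sum (f := fun k => l k ^ 2) (fun _ _ => sq_nonneg _) (Finset.mem_univ k)
  have h2 := hl k
  rw [Real.norm_eq_abs, sq_abs, one_div, inv_mul_eq_div]
  gcongr
  linarith

/-- The function `exp (⟨a, x⟩ - ∑ₖ ⟨bₖ, x⟩² / (2 lₖ²))` as a Schwartz function. -/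
def tiltedGaussian {N : ℕ} (b : OrthonormalBasis (Fin N) ℝ (Config N)) {l : Fin N → ℝ}
    (hl : ∀ k, 0 < l k) (a : Config N) : 𝓢(Config N, ℝ) :=
  expNegSchwartz (fun x => gaussExponent b l x - inner ℝ a x)
    ((hasTemperateGrowth_gaussExponent b l).sub (Function.hasTemperateGrowth_inner_right a)) <| by
      obtain ⟨c, hc, h⟩ := exists_mul_norm_sq_le_gaussExponent b hl
      refine ⟨c / 2, by positivity, ‖a‖ ^ 2 / (2 * c), fun x => ?_⟩
      have h1 := h x
      have h2 := real_inner_le_norm a x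
      have h3 : c * (‖a‖ ^ 2 / (2 * c)) = ‖a‖ ^ 2 / 2 := by field_simp
      have h4 : 0 ≤ c * (‖x‖ ^ 2 * c / 2 - ‖a‖ * ‖x‖ + ‖a‖ ^ 2 / (2 * c)) := by
        rw [mul_add, h3]
        nlinarith [sq_nonneg (c * ‖x‖ - ‖a‖)]
      have h5 := nonneg_of_mul_nonneg_right h4 hc
      linarith

/-- The map `p ↦ p(x) exp (-∑ₖ ⟨bₖ, x⟩² / (2 lₖ²))` from polynomials to Schwartz functions. -/
def polyGauss {N : ℕ} (b : OrthonormalBasis (Fin N) ℝ (Config N)) {l : Fin N → ℝ}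
    (hl : ∀ k, 0 < l k) : MvPolynomial (Fin N) ℝ →ₗ[ℝ] 𝓢(Config N, ℂ) where
  toFun p := SchwartzMap.smulLeftCLM ℂ (fun x : Config N => (MvPolynomial.eval x.ofLp p : ℂ))
    ((tiltedGaussian b hl 0).postcompCLM Complex.ofRealCLM)
  map_add' p q := by
    ext x
    rw [add_apply]
    iterate 3 rw [SchwartzMap.smulLeftCLM_apply_apply (eval_hasTemperateGrowth _)]
    rw [map_add, Complex.ofReal_add, add_smul]
  map_smul' c p := by
    ext x
    rw [smul_apply]
    iterate 2 rw [SchwartzMap.smulLeftCLM_apply_apply (eval_hasTemperateGrowth _)]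
    rw [MvPolynomial.smul_eval, Complex.ofReal_mul, mul_smul, RingHom.id_apply, Complex.coe_smul]

theorem tiltedGaussian_apply {N : ℕ} (b : OrthonormalBasis (Fin N) ℝ (Config N)) {l : Fin N → ℝ}
    (hl : ∀ k, 0 < l k) (a x : Config N) :
    tiltedGaussian b hl a x = Real.exp (-(gaussExponent b l x - inner ℝ a x)) := rfl

theorem polyGauss_apply {N : ℕ} (b : OrthonormalBasis (Fin N) ℝ (Config N)) {l : Fin N → ℝ}
    (hl : ∀ k, 0 < l k) (p : MvPolynomial (Fin N) ℝ) (x : Config N) :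
    polyGauss b hl p x =
      ((MvPolynomial.eval x.ofLp p * Real.exp (-gaussExponent b l x) : ℝ) : ℂ) := by
  simp [polyGauss, SchwartzMap.smulLeftCLM_apply_apply (eval_hasTemperateGrowth _),
    tiltedGaussian_apply]

/-- The map `p ↦ p(x) exp (-∑ₖ ⟨bₖ, x⟩² / (2 lₖ²))` from polynomials to `L²`. -/
def polyState {N : ℕ} (b : OrthonormalBasis (Fin N) ℝ (Config N)) {l : Fin N → ℝ}
    (hl : ∀ k, 0 < l k) : MvPolynomial (Fin N) ℝ →ₗ[ℝ] HilbertSpace N :=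
  (SchwartzMap.toLpCLM ℝ ℂ 2 (volume : Measure (Config N))).toLinearMap ∘ₗ polyGauss b hl

theorem polyState_eq_toLp {N : ℕ} (b : OrthonormalBasis (Fin N) ℝ (Config N)) {l : Fin N → ℝ}
    (hl : ∀ k, 0 < l k) (p : MvPolynomial (Fin N) ℝ) :
    polyState b hl p = (polyGauss b hl p).toLp 2 volume := rfl

theorem coeFn_polyState {N : ℕ} (b : OrthonormalBasis (Fin N) ℝ (Config N)) {l : Fin N → ℝ}
    (hl : ∀ k, 0 < l k) (p : MvPolynomial (Fin N) ℝ) :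
    (polyState b hl p : Config N → ℂ) =ᵐ[volume] fun x =>
      ((MvPolynomial.eval x.ofLp p * Real.exp (-gaussExponent b l x) : ℝ) : ℂ) := by
  filter_upwards [(polyGauss b hl p).coeFn_toLp 2 volume] with x hx
  rw [polyState_eq_toLp, hx, polyGauss_apply]

theorem toDistribution_apply {N : ℕ} (Ψ : HilbertSpace N) (f : 𝓢(Config N, ℂ)) :
    toDistribution N Ψ f = ∫ x, f x * Ψ x := by
  change Lp.toTemperedDistribution Ψ f = _
  rw [Lp.toTemperedDistribution_apply]
  rfl

/-- The distribution defined by `Ψ`, tested on a real function, is the inner product with it. -/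
theorem inner_polyState {N : ℕ} (b : OrthonormalBasis (Fin N) ℝ (Config N)) {l : Fin N → ℝ}
    (hl : ∀ k, 0 < l k) (p : MvPolynomial (Fin N) ℝ) (Ψ : HilbertSpace N) :
    inner ℂ (polyState b hl p) Ψ = toDistribution N Ψ (polyGauss b hl p) := by
  rw [toDistribution_apply, L2.inner_def]
  refine integral_congr_ae ?_
  filter_upwards [coeFn_polyState b hl p] with x hx
  rw [hx, polyGauss_apply, RCLike.inner_apply, Complex.conj_ofReal, mul_comm]

/-! ### Product Hermite functions -/

/-- The normalized Hermite polynomial of degree `n` in the variable `⟨bₖ, x⟩ / lₖ`. -/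
def hermiteFactor {N : ℕ} (b : OrthonormalBasis (Fin N) ℝ (Config N)) (l : Fin N → ℝ)
    (k : Fin N) (n : ℕ) : MvPolynomial (Fin N) ℝ :=
  hermiteNorm n (l k) •
    Polynomial.aeval ((Real.sqrt 2 / l k) • linPoly (b k)) (Polynomial.hermite n)

/-- The product of the normalized Hermite polynomials of degrees `ν` in the variables
`⟨bₖ, x⟩ / lₖ`. -/
def hermitePoly {N : ℕ} (b : OrthonormalBasis (Fin N) ℝ (Config N)) (l : Fin N → ℝ)
    (ν : Fin N → ℕ) : MvPolynomial (Fin N) ℝ :=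
  ∏ k, hermiteFactor b l k (ν k)

theorem eval_hermiteFactor {N : ℕ} (b : OrthonormalBasis (Fin N) ℝ (Config N)) (l : Fin N → ℝ)
    (k : Fin N) (n : ℕ) (x : Config N) :
    MvPolynomial.eval x.ofLp (hermiteFactor b l k n) = hermiteNorm n (l k) *
      Polynomial.aeval (Real.sqrt 2 / l k * inner ℝ (b k) x) (Polynomial.hermite n) := by
  have h : ∀ q : MvPolynomial (Fin N) ℝ, ∀ r : Polynomial ℤ,
      MvPolynomial.eval x.ofLp (Polynomial.aeval q r) =
        Polynomial.aeval (MvPolynomial.eval x.ofLp q) r := fun q r => by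
    rw [Polynomial.aeval_def, Polynomial.aeval_def, Polynomial.hom_eval₂]
    congr 1
    exact RingHom.ext_int _ _
  simp [hermiteFactor, MvPolynomial.smul_eval, h, eval_linPoly]

theorem eval_hermitePoly_mul_exp {N : ℕ} (b : OrthonormalBasis (Fin N) ℝ (Config N))
    (l : Fin N → ℝ) (ν : Fin N → ℕ) (x : Config N) :
    MvPolynomial.eval x.ofLp (hermitePoly b l ν) * Real.exp (-gaussExponent b l x) =
      ∏ k, hermiteFun (ν k) (l k) (inner ℝ (b k) x) := by
  rw [hermitePoly, map_prod, gaussExponent, ← Finset.sum_neg_distrib, Real.exp_sum,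
    ← Finset.prod_mul_distrib]
  refine Finset.prod_congr rfl fun k _ => ?_
  rw [eval_hermiteFactor, hermiteFun_eq, mul_assoc]

theorem totalDegree_hermiteFactor_le {N : ℕ} (b : OrthonormalBasis (Fin N) ℝ (Config N))
    (l : Fin N → ℝ) (k : Fin N) (n : ℕ) : (hermiteFactor b l k n).totalDegree ≤ n := by
  refine (MvPolynomial.totalDegree_smul_le _ _).trans ?_
  rw [Polynomial.aeval_eq_sum_range, Polynomial.natDegree_hermite]
  refine MvPolynomial.totalDegree_finsetSum_le fun i hi => ?_
  rw [← Int.cast_smul_eq_zsmul ℝ]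
  refine (MvPolynomial.totalDegree_smul_le _ _).trans ((MvPolynomial.totalDegree_pow _ _).trans ?_)
  have h : ((Real.sqrt 2 / l k) • linPoly (b k)).totalDegree ≤ 1 :=
    (MvPolynomial.totalDegree_smul_le _ _).trans (totalDegree_linPoly_le _)
  have h2 := Finset.mem_range.1 hi
  nlinarith

theorem integral_prod_inner {N : ℕ} (b : OrthonormalBasis (Fin N) ℝ (Config N))
    (f : Fin N → ℝ → ℝ) : ∫ x : Config N, ∏ k, f k (inner ℝ (b k) x) = ∏ k, ∫ y, f k y := by
  have h1 := (b.repr.measurePreserving).integral_comp b.repr.toHomeomorph.measurableEmbedding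
    (fun y : EuclideanSpace ℝ (Fin N) => ∏ k, f k (y k))
  have h2 := (EuclideanSpace.volume_preserving_symm_measurableEquiv_toLp (Fin N)).integral_comp
    (MeasurableEquiv.measurableEmbedding _) (fun y : Fin N → ℝ => ∏ k, f k (y k))
  simp only [b.repr_apply_apply] at h1
  rw [h1, ← integral_fintype_prod_volume_eq_prod]
  exact h2

theorem inner_polyState_polyState {N : ℕ} (b : OrthonormalBasis (Fin N) ℝ (Config N))
    {l : Fin N → ℝ} (hl : ∀ k, 0 < l k) (p q : MvPolynomial (Fin N) ℝ) :
    inner ℂ (polyState b hl p) (polyState b hl q) =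
      ((∫ x : Config N, (MvPolynomial.eval x.ofLp p * Real.exp (-gaussExponent b l x)) *
        (MvPolynomial.eval x.ofLp q * Real.exp (-gaussExponent b l x)) : ℝ) : ℂ) := by
  rw [L2.inner_def, ← integral_complex_ofReal]
  refine integral_congr_ae ?_
  filter_upwards [coeFn_polyState b hl p, coeFn_polyState b hl q] with x hx hy
  rw [hx, hy, RCLike.inner_apply, Complex.conj_ofReal, mul_comm]
  push_cast
  ring

theorem orthonormal_hermiteState {N : ℕ} (b : OrthonormalBasis (Fin N) ℝ (Config N))
    {l : Fin N → ℝ} (hl : ∀ k, 0 < l k) :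
    Orthonormal ℂ (fun ν : Fin N → ℕ => polyState b hl (hermitePoly b l ν)) := by
  classical
  rw [orthonormal_iff_ite]
  intro ν μ
  rw [inner_polyState_polyState]
  simp_rw [eval_hermitePoly_mul_exp, ← Finset.prod_mul_distrib]
  rw [integral_prod_inner b (fun k y => hermiteFun (ν k) (l k) y * hermiteFun (μ k) (l k) y)]
  simp_rw [integral_hermiteFun_mul _ _ (hl _)]
  rw [Finset.prod_ite_zero]
  simp [funext_iff, apply_ite]

/-! ### The eigenvalue equation -/

/-- The derivative in the direction `bᵢ` of a product of functions of the coordinates `⟨bₖ, x⟩`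
acts on the `i`-th factor only. -/
theorem lineDeriv_prod_inner {N : ℕ} (b : OrthonormalBasis (Fin N) ℝ (Config N))
    (g : Fin N → ℝ → ℝ) (i : Fin N) (hg : Differentiable ℝ (g i)) (x : Config N) :
    lineDeriv ℝ (fun x => ((∏ k, g k (inner ℝ (b k) x) : ℝ) : ℂ)) x (b i) =
      ((∏ k, Function.update g i (deriv (g i)) k (inner ℝ (b k) x) : ℝ) : ℂ) := by
  rw [lineDeriv]
  have h : ∀ t : ℝ, ∏ k, g k (inner ℝ (b k) (x + t • b i)) =
      g i (inner ℝ (b i) x + t) * ∏ k ∈ Finset.univ.erase i, g k (inner ℝ (b k) x) := fun t => by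
    rw [← Finset.mul_prod_erase _ _ (Finset.mem_univ i)]
    congr 1
    · simp [inner_add_right, inner_smul_right]
    · refine Finset.prod_congr rfl fun k hk => ?_
      rw [inner_add_right, inner_smul_right, b.inner_eq_zero (Finset.ne_of_mem_erase hk)]
      simp
  simp_rw [h]
  rw [← Finset.mul_prod_erase _ _ (Finset.mem_univ i), Function.update_self]
  have h2 : HasDerivAt (fun t : ℝ => g i (inner ℝ (b i) x + t)) (deriv (g i) (inner ℝ (b i) x))
      0 := by
    have := (hg (inner ℝ (b i) x + 0)).hasDerivAt.comp_const_add (inner ℝ (b i) x) 0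
    simpa using this
  rw [((h2.mul_const _).ofReal_comp).deriv]
  congr 2
  refine Finset.prod_congr rfl fun k hk => ?_
  rw [Function.update_of_ne (Finset.ne_of_mem_erase hk)]

/-- The product Hermite functions solve the equation of the anisotropic oscillator. -/
theorem laplacian_hermiteState {N : ℕ} (b : OrthonormalBasis (Fin N) ℝ (Config N))
    {l : Fin N → ℝ} (hl : ∀ k, 0 < l k) (ν : Fin N → ℕ) (x : Config N) :
    (Δ (polyGauss b hl (hermitePoly b l ν))) x =
      ((∑ k, (inner ℝ (b k) x ^ 2 / l k ^ 4 - (2 * ν k + 1) / l k ^ 2) : ℝ) : ℂ) *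
        polyGauss b hl (hermitePoly b l ν) x := by
  have h0 : (polyGauss b hl (hermitePoly b l ν) : Config N → ℂ) =
      fun x => ((∏ k, hermiteFun (ν k) (l k) (inner ℝ (b k) x) : ℝ) : ℂ) :=
    funext fun x => by rw [polyGauss_apply, eval_hermitePoly_mul_exp]
  rw [SchwartzMap.laplacian_eq_sum b, sum_apply, Complex.ofReal_sum, Finset.sum_mul]
  refine Finset.sum_congr rfl fun i _ => ?_
  set g : Fin N → ℝ → ℝ := fun k => hermiteFun (ν k) (l k) with hg
  rw [SchwartzMap.lineDerivOp_apply]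
  have h1 : ((LineDeriv.lineDerivOp (b i) (polyGauss b hl (hermitePoly b l ν)) :
      𝓢(Config N, ℂ)) : Config N → ℂ) = fun x =>
      ((∏ k, Function.update g i (deriv (g i)) k (inner ℝ (b k) x) : ℝ) : ℂ) := by
    funext x
    rw [SchwartzMap.lineDerivOp_apply, h0]
    exact lineDeriv_prod_inner b g i (differentiable_hermiteFun _ _) x
  rw [h1, lineDeriv_prod_inner, Function.update_self, Function.update_idem, h0]
  · beta_reduce
    rw [← Finset.mul_prod_erase _ _ (Finset.mem_univ i),
      ← Finset.mul_prod_erase _ (fun k => hermiteFun (ν k) (l k) (inner ℝ (b k) x))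
        (Finset.mem_univ i), Function.update_self, hg]
    dsimp only
    rw [(hasDerivAt_deriv_hermiteFun (ν i) (hl i) _).deriv]
    have h3 : ∏ k ∈ Finset.univ.erase i, Function.update (fun k => hermiteFun (ν k) (l k)) i
        (deriv (deriv (hermiteFun (ν i) (l i)))) k (inner ℝ (b k) x) =
        ∏ k ∈ Finset.univ.erase i, hermiteFun (ν k) (l k) (inner ℝ (b k) x) :=
      Finset.prod_congr rfl fun k hk => by
        rw [Function.update_of_ne (Finset.ne_of_mem_erase hk)]
    rw [h3]
    push_cast
    ring
  · rw [Function.update_self]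
    exact fun y => (hasDerivAt_deriv_hermiteFun (ν i) (hl i) y).differentiableAt

/-! ### Spans of Hermite polynomials -/

/-- The three-term recurrence of the Hermite polynomials. For `n = 0` the coefficient `β`
vanishes, so that the truncated index `n - 1` is harmless. -/
theorem exists_linPoly_mul_hermiteFactor {N : ℕ} (b : OrthonormalBasis (Fin N) ℝ (Config N))
    {l : Fin N → ℝ} (hl : ∀ k, 0 < l k) (k : Fin N) (n : ℕ) :
    ∃ α β : ℝ, linPoly (b k) * hermiteFactor b l k n =
      α • hermiteFactor b l k (n + 1) + β • hermiteFactor b l k (n - 1) := by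
  set c := Real.sqrt 2 / l k with hc
  have hc0 : c ≠ 0 := (div_pos (by positivity) (hl k)).ne'
  have hn : ∀ n, hermiteNorm n (l k) ≠ 0 := fun n => (hermiteNorm_pos n (hl k)).ne'
  set H : ℕ → MvPolynomial (Fin N) ℝ :=
    fun n => Polynomial.aeval (c • linPoly (b k)) (Polynomial.hermite n) with hH
  have hder : Polynomial.derivative (Polynomial.hermite n) =
      (n : Polynomial ℤ) * Polynomial.hermite (n - 1) := by
    cases n with
    | zero => simp
    | succ n => simpa using derivative_hermite_succ n
  have key : c • linPoly (b k) * H n = H (n + 1) + (n : ℝ) • H (n - 1) := by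
    simp only [hH]
    rw [Polynomial.hermite_succ, hder]
    simp [Nat.cast_smul_eq_nsmul]
  have key2 : linPoly (b k) * H n = c⁻¹ • H (n + 1) + (c⁻¹ * n) • H (n - 1) := by
    rw [mul_smul, ← smul_add, ← key, smul_mul_assoc, inv_smul_smul₀ hc0]
  refine ⟨hermiteNorm n (l k) * c⁻¹ * (hermiteNorm (n + 1) (l k))⁻¹,
    hermiteNorm n (l k) * (c⁻¹ * n) * (hermiteNorm (n - 1) (l k))⁻¹, ?_⟩
  have e : ∀ n, hermiteFactor b l k n = hermiteNorm n (l k) • H n := fun n => rfl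
  rw [e, e, e, mul_smul_comm, key2, smul_smul, smul_smul, inv_mul_cancel_right₀ (hn _),
    inv_mul_cancel_right₀ (hn _), smul_add, smul_smul, smul_smul]

/-- The span of the product Hermite polynomials of total degree at most `n`. -/
def hermiteSpan {N : ℕ} (b : OrthonormalBasis (Fin N) ℝ (Config N)) (l : Fin N → ℝ) (n : ℕ) :
    Submodule ℝ (MvPolynomial (Fin N) ℝ) :=
  Submodule.span ℝ (hermitePoly b l '' {ν | ∑ k, ν k ≤ n})

theorem one_mem_hermiteSpan {N : ℕ} (b : OrthonormalBasis (Fin N) ℝ (Config N)) {l : Fin N → ℝ}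
    (hl : ∀ k, 0 < l k) : 1 ∈ hermiteSpan b l 0 := by
  have h : hermitePoly b l 0 ∈ hermiteSpan b l 0 :=
    Submodule.subset_span ⟨0, by simp, rfl⟩
  have h2 : hermitePoly b l 0 = (∏ k, hermiteNorm 0 (l k)) • 1 := by
    simp [hermitePoly, hermiteFactor, Finset.prod_smul]
  rw [h2] at h
  exact (Submodule.smul_mem_iff _
    (Finset.prod_pos fun k _ => hermiteNorm_pos 0 (hl k)).ne').1 h

theorem linPoly_mul_mem_hermiteSpan {N : ℕ} (b : OrthonormalBasis (Fin N) ℝ (Config N))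
    {l : Fin N → ℝ} (hl : ∀ k, 0 < l k) (a : Config N) {n : ℕ} {p : MvPolynomial (Fin N) ℝ}
    (hp : p ∈ hermiteSpan b l n) : linPoly a * p ∈ hermiteSpan b l (n + 1) := by
  induction hp using Submodule.span_induction with
  | zero => simp
  | add p q _ _ hp hq => rw [mul_add]; exact add_mem hp hq
  | smul c p _ hp => rw [mul_smul_comm]; exact Submodule.smul_mem _ _ hp
  | mem p hp =>
    obtain ⟨ν, hν, rfl⟩ := hp
    simp only [Set.mem_ofPred_eq] at hν
    rw [← b.sum_repr' a, map_sum, Finset.sum_mul]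
    refine Submodule.sum_mem _ fun k _ => ?_
    rw [map_smul, smul_mul_assoc]
    refine Submodule.smul_mem _ _ ?_
    obtain ⟨α, β, h⟩ := exists_linPoly_mul_hermiteFactor b hl k (ν k)
    have hup : ∀ m, hermitePoly b l (Function.update ν k m) =
        hermiteFactor b l k m * ∏ i ∈ Finset.univ.erase k, hermiteFactor b l i (ν i) := fun m => by
      rw [hermitePoly, ← Finset.mul_prod_erase _ _ (Finset.mem_univ k), Function.update_self]
      congr 1
      refine Finset.prod_congr rfl fun i hi => ?_
      rw [Function.update_of_ne (Finset.ne_of_mem_erase hi)]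
    have hmem : ∀ m, m ≤ ν k + 1 →
        hermitePoly b l (Function.update ν k m) ∈ hermiteSpan b l (n + 1) := fun m hm => by
      refine Submodule.subset_span ⟨_, ?_, rfl⟩
      have h1 : ∑ i, Function.update ν k m i = m + ∑ i ∈ Finset.univ.erase k, ν i := by
        rw [← Finset.add_sum_erase _ _ (Finset.mem_univ k), Function.update_self]
        congr 1
        refine Finset.sum_congr rfl fun i hi => ?_
        rw [Function.update_of_ne (Finset.ne_of_mem_erase hi)]
      rw [← Finset.add_sum_erase _ _ (Finset.mem_univ k)] at hν
      simp only [Set.mem_ofPred_eq]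
      omega
    have h2 := hup (ν k)
    rw [Function.update_eq_self] at h2
    rw [h2, ← mul_assoc, h, add_mul, smul_mul_assoc, smul_mul_assoc, ← hup, ← hup]
    exact add_mem (Submodule.smul_mem _ _ (hmem _ le_rfl))
      (Submodule.smul_mem _ _ (hmem _ (by omega)))

theorem linPoly_pow_mem_hermiteSpan {N : ℕ} (b : OrthonormalBasis (Fin N) ℝ (Config N))
    {l : Fin N → ℝ} (hl : ∀ k, 0 < l k) (a : Config N) (n : ℕ) :
    linPoly a ^ n ∈ hermiteSpan b l n := by
  induction n with
  | zero => simpa using one_mem_hermiteSpan b hl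
  | succ n ih => rw [pow_succ']; exact linPoly_mul_mem_hermiteSpan b hl a ih

theorem prod_linPoly_mem_hermiteSpan {N : ℕ} (b : OrthonormalBasis (Fin N) ℝ (Config N))
    {l : Fin N → ℝ} (hl : ∀ k, 0 < l k) {ι : Type*} (s : Finset ι) (a : ι → Config N) :
    ∏ i ∈ s, linPoly (a i) ∈ hermiteSpan b l s.card := by
  classical
  induction s using Finset.induction_on with
  | empty => simpa using one_mem_hermiteSpan b hl
  | insert i s hi ih =>
    rw [Finset.prod_insert hi, Finset.card_insert_of_notMem hi]
    exact linPoly_mul_mem_hermiteSpan b hl _ ih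

theorem polyState_smul {N : ℕ} (b : OrthonormalBasis (Fin N) ℝ (Config N)) {l : Fin N → ℝ}
    (hl : ∀ k, 0 < l k) (c : ℝ) (p : MvPolynomial (Fin N) ℝ) :
    polyState b hl (c • p) = (c : ℂ) • polyState b hl p := by
  have h : polyGauss b hl (c • p) = (c : ℂ) • polyGauss b hl p := by
    ext x
    rw [map_smul, smul_apply, smul_apply, Complex.coe_smul]
  rw [polyState_eq_toLp, h]
  exact map_smul (SchwartzMap.toLpCLM ℂ ℂ 2 (volume : Measure (Config N))) _ _

theorem inner_polyState_eq_zero_of_mem_hermiteSpan {N : ℕ}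
    (b : OrthonormalBasis (Fin N) ℝ (Config N)) {l : Fin N → ℝ} (hl : ∀ k, 0 < l k) {n : ℕ}
    {p : MvPolynomial (Fin N) ℝ} (hp : p ∈ hermiteSpan b l n) (Ψ : HilbertSpace N)
    (h : ∀ ν : Fin N → ℕ, ∑ k, ν k ≤ n → inner ℂ (polyState b hl (hermitePoly b l ν)) Ψ = 0) :
    inner ℂ (polyState b hl p) Ψ = 0 := by
  induction hp using Submodule.span_induction with
  | zero => simp
  | add p q _ _ hp hq => rw [map_add, inner_add_left, hp, hq, add_zero]
  | smul c p _ hp =>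
    rw [polyState_smul, inner_smul_left, hp, mul_zero]
  | mem p hp =>
    obtain ⟨ν, hν, rfl⟩ := hp
    exact h ν hν

/-! ### Completeness -/

theorem integrable_tiltedGaussian_mul {N : ℕ} (b : OrthonormalBasis (Fin N) ℝ (Config N))
    {l : Fin N → ℝ} (hl : ∀ k, 0 < l k) (a : Config N) (Ψ : HilbertSpace N) :
    Integrable (fun x => (tiltedGaussian b hl a x : ℂ) * Ψ x) volume :=
  MemLp.integrable_mul (p := 2) (q := 2)
    (((tiltedGaussian b hl a).postcompCLM Complex.ofRealCLM).memLp 2 volume) (Lp.memLp Ψ)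

/-- If `Ψ` is orthogonal to all polynomials times the Gaussian weight `w`, then the Fourier
transform of `w Ψ` vanishes, by expanding the plane waves in power series. -/
theorem integral_cexp_mul_eq_zero {N : ℕ} (b : OrthonormalBasis (Fin N) ℝ (Config N))
    {l : Fin N → ℝ} (hl : ∀ k, 0 < l k) (Ψ : HilbertSpace N)
    (h : ∀ a n, inner ℂ (polyState b hl (linPoly a ^ n)) Ψ = 0) (a : Config N) :
    ∫ x, Complex.exp (Complex.I * (inner ℝ a x : ℝ)) * ((tiltedGaussian b hl 0 x : ℂ) * Ψ x) =
      0 := by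
  set u : Config N → ℂ := fun x => (tiltedGaussian b hl 0 x : ℂ) * Ψ x with hu
  have hui : Integrable u volume := integrable_tiltedGaussian_mul b hl 0 Ψ
  have hinner : Continuous fun x : Config N => inner ℝ a x := by fun_prop
  have hreal : ∀ t : ℝ, HasSum (fun n : ℕ => t ^ n / n.factorial) (Real.exp t) := fun t => by
    rw [Real.exp_eq_exp_ℝ]; exact NormedSpace.expSeries_div_hasSum_exp t
  have hbound : ∀ x, HasSum (fun n : ℕ => |inner ℝ a x| ^ n / n.factorial * ‖u x‖)
      (Real.exp |inner ℝ a x| * ‖u x‖) := fun x => (hreal _).mul_right _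
  have hint : Integrable (fun x => Real.exp |inner ℝ a x| * ‖u x‖) volume := by
    refine ((integrable_tiltedGaussian_mul b hl a Ψ).norm.add
      (integrable_tiltedGaussian_mul b hl (-a) Ψ).norm).mono' ?_ ?_
    · exact ((Real.continuous_exp.comp hinner.abs).aestronglyMeasurable).mul
        hui.aestronglyMeasurable.norm
    · refine Filter.Eventually.of_forall fun x => ?_
      -- The series is dominated by the Gaussians tilted by `a` and `-a`, which are in `L²`.
      have e1 : Real.exp |inner ℝ a x| ≤ Real.exp (inner ℝ a x) + Real.exp (-inner ℝ a x) := by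
        rcases abs_cases (inner ℝ a x) with h | h <;> rw [h.1] <;>
          linarith [Real.exp_pos (inner ℝ a x), Real.exp_pos (-inner ℝ a x)]
      have e2 : ∀ s : Config N, ‖(tiltedGaussian b hl s x : ℂ) * Ψ x‖ =
          Real.exp (inner ℝ s x) * ‖u x‖ := fun s => by
        simp only [hu, norm_mul, Complex.norm_real, tiltedGaussian_apply, Real.norm_eq_abs,
          Real.abs_exp]
        rw [← mul_assoc, ← Real.exp_add]
        congr 2
        simp
        ring
      rw [Real.norm_of_nonneg (by positivity), Pi.add_apply, e2 a, e2 (-a), inner_neg_left,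
        ← add_mul]
      gcongr
  have hs := hasSum_integral_of_dominated_convergence (μ := (volume : Measure (Config N)))
    (F := fun (n : ℕ) x => (Complex.I * (inner ℝ a x : ℝ)) ^ n / n.factorial * u x)
    (f := fun x => Complex.exp (Complex.I * (inner ℝ a x : ℝ)) * u x)
    (fun n x => |inner ℝ a x| ^ n / n.factorial * ‖u x‖)
    (fun n => by
      refine AEStronglyMeasurable.mul (Continuous.aestronglyMeasurable ?_)
        hui.aestronglyMeasurable
      fun_prop)
    (fun n => Filter.Eventually.of_forall fun x => by simp)
    (Filter.Eventually.of_forall fun x => (hbound x).summable)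
    (by simpa only [(hbound _).tsum_eq] using hint)
    (Filter.Eventually.of_forall fun x => by
      have := NormedSpace.expSeries_div_hasSum_exp (Complex.I * (inner ℝ a x : ℝ))
      rw [← Complex.exp_eq_exp_ℂ] at this
      exact this.mul_right _)
  have hz : ∀ n : ℕ, ∫ x, (Complex.I * (inner ℝ a x : ℝ)) ^ n / n.factorial * u x = 0 := by
    intro n
    have h1 := h a n
    rw [inner_polyState, toDistribution_apply] at h1
    have h2 : ∀ x, (Complex.I * (inner ℝ a x : ℝ)) ^ n / n.factorial * u x =
        (Complex.I ^ n / n.factorial) * (polyGauss b hl (linPoly a ^ n) x * Ψ x) := fun x => by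
      simp only [hu, polyGauss_apply, tiltedGaussian_apply, map_pow, eval_linPoly, inner_zero_left,
        sub_zero]
      push_cast
      ring
    simp_rw [h2]
    rw [integral_const_mul, h1, mul_zero]
  simp_rw [hz] at hs
  exact hs.unique hasSum_zero

/-- Powers of linear forms times the Gaussian weight `w` are total in `L²`: if `Ψ` is orthogonal
to them, the integrable function `w Ψ` has vanishing Fourier transform, hence vanishes. -/
theorem eq_zero_of_inner_linPoly_pow_eq_zero {N : ℕ} (b : OrthonormalBasis (Fin N) ℝ (Config N))
    {l : Fin N → ℝ} (hl : ∀ k, 0 < l k) (Ψ : HilbertSpace N)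
    (h : ∀ a n, inner ℂ (polyState b hl (linPoly a ^ n)) Ψ = 0) : Ψ = 0 := by
  set u : Config N → ℂ := fun x => (tiltedGaussian b hl 0 x : ℂ) * Ψ x with hu
  have hui : Integrable u volume := integrable_tiltedGaussian_mul b hl 0 Ψ
  have hF : FourierTransform.fourier u = 0 := by
    funext ξ
    rw [Real.fourier_eq', Pi.zero_apply, ← integral_cexp_mul_eq_zero b hl Ψ h (-(2 * Real.pi) • ξ)]
    refine integral_congr_ae (Filter.Eventually.of_forall fun x => ?_)
    simp only [smul_eq_mul]
    congr 2
    rw [inner_smul_left, real_inner_comm]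
    simp
    ring
  have htest : ∀ f : 𝓢(Config N, ℂ), ∫ x, f x * u x = 0 := fun f => by
    have h1 := VectorFourier.integral_bilin_fourierIntegral_eq_flip
      (ContinuousLinearMap.mul ℂ ℂ) (L := innerₗ (Config N)) (μ := volume) (ν := volume)
      Real.continuous_fourierChar continuous_inner
      (FourierTransformInv.fourierInv f : 𝓢(Config N, ℂ)).integrable hui
    have h2 : VectorFourier.fourierIntegral Real.fourierChar volume (innerₗ (Config N)).flip u =
        0 := by
      rw [← hF, flip_innerₗ]; rfl
    have h3 : VectorFourier.fourierIntegral Real.fourierChar volume (innerₗ (Config N))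
        (FourierTransformInv.fourierInv f : 𝓢(Config N, ℂ)) = f := by
      have : FourierTransform.fourier (FourierTransformInv.fourierInv f : 𝓢(Config N, ℂ)) = f :=
        FourierTransform.fourier_fourierInv_eq f
      conv_rhs => rw [← this]
      rfl
    rw [h2, h3] at h1
    simpa using h1
  have hu0 : ∀ᵐ x ∂volume, u x = 0 := by
    refine ae_eq_zero_of_integral_contDiff_smul_eq_zero hui.locallyIntegrable fun g hg hgc => ?_
    have hg₁ : HasCompactSupport (Complex.ofRealCLM ∘ g) := hgc.comp_left rfl
    have hg₂ : ContDiff ℝ ((⊤ : ℕ∞) : WithTop ℕ∞) (Complex.ofRealCLM ∘ g) := by fun_prop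
    rw [← htest (hg₁.toSchwartzMap hg₂)]
    simp
  rw [Lp.eq_zero_iff_ae_eq_zero]
  filter_upwards [hu0] with x hx
  simpa [hu, tiltedGaussian_apply] using hx

/-- The product Hermite functions form a Hilbert basis of `L²`. -/
def hermiteBasis {N : ℕ} (b : OrthonormalBasis (Fin N) ℝ (Config N)) {l : Fin N → ℝ}
    (hl : ∀ k, 0 < l k) : HilbertBasis (Fin N → ℕ) ℂ (HilbertSpace N) :=
  HilbertBasis.mkOfOrthogonalEqBot (orthonormal_hermiteState b hl) <| by
    rw [Submodule.eq_bot_iff]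
    intro Ψ hΨ
    refine eq_zero_of_inner_linPoly_pow_eq_zero b hl Ψ fun a n =>
      inner_polyState_eq_zero_of_mem_hermiteSpan b hl (linPoly_pow_mem_hermiteSpan b hl a n) Ψ
        fun ν _ => ?_
    exact (Submodule.mem_orthogonal _ _).1 hΨ _ (Submodule.subset_span ⟨ν, rfl⟩)

theorem hermiteBasis_apply {N : ℕ} (b : OrthonormalBasis (Fin N) ℝ (Config N)) {l : Fin N → ℝ}
    (hl : ∀ k, 0 < l k) (ν : Fin N → ℕ) :
    hermiteBasis b hl ν = polyState b hl (hermitePoly b l ν) := by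
  rw [hermiteBasis, HilbertBasis.coe_mkOfOrthogonalEqBot]

/-! ### Normal coordinates -/

/-- The squares of the relative normal coordinates telescope: with `S` the sum of the first `k`
coordinates, `(S - k x)² / (k (k + 1)) = S² / k + x² - (S + x)² / (k + 1)`. -/
theorem sum_sq_sub_partial_sums (f : ℕ → ℝ) (n : ℕ) :
    ∑ k ∈ Finset.range n, (∑ i ∈ Finset.range (k + 1), f i - ((k : ℝ) + 1) * f (k + 1)) ^ 2 /
        (((k : ℝ) + 1) * ((k : ℝ) + 2)) =
      ∑ i ∈ Finset.range (n + 1), f i ^ 2 -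
        (∑ i ∈ Finset.range (n + 1), f i) ^ 2 / ((n : ℝ) + 1) := by
  induction n with
  | zero => simp
  | succ n ih =>
    rw [Finset.sum_range_succ, ih, Finset.sum_range_succ _ (n + 1),
      Finset.sum_range_succ (fun i => f i) (n + 1)]
    generalize ∑ i ∈ Finset.range (n + 1), f i = S
    have h1 : (n : ℝ) + 1 ≠ 0 := by positivity
    have h2 : (n : ℝ) + 2 ≠ 0 := by positivity
    have h3 : (n : ℝ) + 1 + 1 = n + 2 := by ring
    push_cast
    rw [h3]
    field_simp
    ring

theorem normalCoord_zero {n : ℕ} (x : Config (n + 1)) :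
    normalCoord x 0 = (∑ i, x i) / Real.sqrt ((n + 1 : ℕ) : ℝ) := by
  simp [normalCoord]

/-- The normal coordinates preserve the Euclidean norm. -/
theorem sum_normalCoord_sq {N : ℕ} (hN : 1 ≤ N) (x : Config N) :
    ∑ k, normalCoord x k ^ 2 = ∑ i, x i ^ 2 := by
  obtain ⟨n, rfl⟩ : ∃ n, N = n + 1 := ⟨N - 1, by omega⟩
  let f : ℕ → ℝ := fun i => if h : i < n + 1 then x ⟨i, h⟩ else 0
  have hf : ∀ i : Fin (n + 1), x i = f i := fun i => by
    simp only [f, dif_pos i.2]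
  have hIio : ∀ k : Fin (n + 1), ∑ i ∈ Finset.Iio k, x i = ∑ i ∈ Finset.range k, f i := fun k => by
    rw [← Nat.Iio_eq_range, ← Fin.map_valEmbedding_Iio, Finset.sum_map]
    exact Finset.sum_congr rfl fun i _ => hf i
  have hsum : ∑ i, x i = ∑ i ∈ Finset.range (n + 1), f i := by
    rw [← Fin.sum_univ_eq_sum_range f (n + 1)]
    exact Finset.sum_congr rfl fun i _ => hf i
  have hsq : ∑ i, x i ^ 2 = ∑ i ∈ Finset.range (n + 1), f i ^ 2 := by
    rw [← Fin.sum_univ_eq_sum_range (fun i => f i ^ 2) (n + 1)]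
    exact Finset.sum_congr rfl fun i _ => by rw [hf i]
  have hsucc : ∀ k : Fin n, normalCoord x k.succ ^ 2 =
      (fun k : ℕ => (∑ i ∈ Finset.range (k + 1), f i - ((k : ℝ) + 1) * f (k + 1)) ^ 2 /
        (((k : ℝ) + 1) * ((k : ℝ) + 2))) k := fun k => by
    have h0 : ((k.succ : Fin (n + 1)) : ℕ) ≠ 0 := by simp
    rw [normalCoord, if_neg h0, hIio, hf, div_pow, Real.sq_sqrt (by positivity), Fin.val_succ]
    push_cast
    congr 2
    ring
  rw [Fin.sum_univ_succ, Finset.sum_congr rfl fun k _ => hsucc k,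
    Fin.sum_univ_eq_sum_range (fun k : ℕ =>
      (∑ i ∈ Finset.range (k + 1), f i - ((k : ℝ) + 1) * f (k + 1)) ^ 2 /
        (((k : ℝ) + 1) * ((k : ℝ) + 2))) n, sum_sq_sub_partial_sums, normalCoord_zero, div_pow,
    Real.sq_sqrt (by positivity), hsum, hsq]
  push_cast
  ring

/-- The map to normal coordinates, as a linear isometry. -/
def normalIsometry {N : ℕ} (hN : 1 ≤ N) : Config N →ₗᵢ[ℝ] Config N where
  toFun x := WithLp.toLp 2 fun k => normalCoord x k
  map_add' x y := by
    ext k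
    simp only [normalCoord, PiLp.add_apply, Finset.sum_add_distrib]
    split_ifs <;> ring
  map_smul' c x := by
    ext k
    simp only [normalCoord, PiLp.smul_apply, smul_eq_mul, ← Finset.mul_sum, RingHom.id_apply]
    split_ifs <;> ring
  norm_map' x := by
    rw [EuclideanSpace.norm_eq, EuclideanSpace.norm_eq]
    simpa using congrArg Real.sqrt (sum_normalCoord_sq hN x)

/-- The orthonormal basis dual to the normal coordinates. -/
def normalBasis {N : ℕ} (hN : 1 ≤ N) : OrthonormalBasis (Fin N) ℝ (Config N) :=
  OrthonormalBasis.ofRepr ((normalIsometry hN).toLinearIsometryEquiv rfl)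

theorem inner_normalBasis {N : ℕ} (hN : 1 ≤ N) (k : Fin N) (x : Config N) :
    inner ℝ (normalBasis hN k) x = normalCoord x k := by
  rw [← OrthonormalBasis.repr_apply_apply]
  rfl

theorem sum_ite_mul_normalCoord_sq {N : ℕ} (hN : 1 ≤ N) (x : Config N) (a c : ℝ) :
    ∑ k : Fin N, (if (k : ℕ) = 0 then a else c) * normalCoord x k ^ 2 =
      a * ((∑ i, x i) ^ 2 / N) + c * (∑ i, x i ^ 2 - (∑ i, x i) ^ 2 / N) := by
  have h := sum_normalCoord_sq hN x
  obtain ⟨n, rfl⟩ : ∃ n, N = n + 1 := ⟨N - 1, by omega⟩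
  rw [Fin.sum_univ_succ, normalCoord_zero, div_pow, Real.sq_sqrt (by positivity)] at h
  rw [Fin.sum_univ_succ, normalCoord_zero, div_pow, Real.sq_sqrt (by positivity), ← h]
  simp [Finset.mul_sum]

theorem sum_sum_Ioi_sub_sq {N : ℕ} (x : Config N) :
    ∑ i, ∑ j ∈ Finset.Ioi i, (x i - x j) ^ 2 = N * ∑ i, x i ^ 2 - (∑ i, x i) ^ 2 := by
  have h := Finset.sum_sum_Ioi_add_eq_sum_sum_off_diag (fun i j : Fin N => (x i - x j) ^ 2)
  have h1 : ∀ i j : Fin N, (x j - x i) ^ 2 + (x i - x j) ^ 2 = 2 * (x i - x j) ^ 2 :=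
    fun i j => by ring
  have h2 : ∀ i : Fin N, ∑ j ∈ {i}ᶜ, (x j - x i) ^ 2 = ∑ j, (x j - x i) ^ 2 := fun i =>
    Finset.sum_subset (Finset.subset_univ _) fun j _ hj => by
      have : j = i := by simpa using hj
      simp [this]
  simp_rw [h1, h2, ← Finset.mul_sum] at h
  have h3 : ∑ i, ∑ j, (x j - x i) ^ 2 = 2 * (N * ∑ i, x i ^ 2 - (∑ i, x i) ^ 2) := by
    have : ∀ i j : Fin N, (x j - x i) ^ 2 = x j ^ 2 + x i ^ 2 - 2 * (x i * x j) :=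
      fun i j => by ring
    simp_rw [this, Finset.sum_sub_distrib, Finset.sum_add_distrib, ← Finset.mul_sum,
      ← Finset.sum_mul]
    simp [← Finset.mul_sum]
    ring
  linarith

/-! ### Length scales and energies -/

/-- The length scale of the `k`-th normal mode. -/
def modeLength (N : ℕ) (ħ m ω D : ℝ) (k : Fin N) : ℝ :=
  if (k : ℕ) = 0 then lengthMinus ħ m ω else lengthPlus N ħ m ω D

section Parameters

variable {N : ℕ} {ħ m ω D : ℝ}

theorem stiffnessPlus_pos (hN : 1 ≤ N) (hD : -(m * ω ^ 2 / N) < D) :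
    0 < m * ω ^ 2 + N * D := by
  have hN' : (0 : ℝ) < N := by exact_mod_cast hN
  have := mul_lt_mul_of_pos_left hD hN'
  rw [mul_neg, mul_div_cancel₀ _ hN'.ne'] at this
  linarith

theorem freqMinus_pos (hm : 0 < m) (hω : 0 < ω) : 0 < freqMinus m ω :=
  Real.sqrt_pos.2 (by positivity)

theorem freqPlus_pos (hN : 1 ≤ N) (hm : 0 < m) (hD : -(m * ω ^ 2 / N) < D) :
    0 < freqPlus N m ω D :=
  Real.sqrt_pos.2 (div_pos (stiffnessPlus_pos hN hD) hm)

theorem freqMinus_sq (hm : 0 < m) : m * freqMinus m ω ^ 2 = m * ω ^ 2 := by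
  rw [freqMinus, Real.sq_sqrt (by positivity)]
  field_simp

theorem freqPlus_sq (hN : 1 ≤ N) (hm : 0 < m) (hD : -(m * ω ^ 2 / N) < D) :
    m * freqPlus N m ω D ^ 2 = m * ω ^ 2 + N * D := by
  rw [freqPlus, Real.sq_sqrt (div_pos (stiffnessPlus_pos hN hD) hm).le]
  field_simp

theorem lengthMinus_sq (hħ : 0 < ħ) (hm : 0 < m) (hω : 0 < ω) :
    lengthMinus ħ m ω ^ 2 = ħ / (m * freqMinus m ω) := by
  have := freqMinus_pos hm hω
  rw [lengthMinus, Real.sq_sqrt (by positivity)]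

theorem lengthPlus_sq (hN : 1 ≤ N) (hħ : 0 < ħ) (hm : 0 < m) (hD : -(m * ω ^ 2 / N) < D) :
    lengthPlus N ħ m ω D ^ 2 = ħ / (m * freqPlus N m ω D) := by
  have := freqPlus_pos hN hm hD
  rw [lengthPlus, Real.sq_sqrt (by positivity)]

theorem modeLength_pos (hN : 1 ≤ N) (hħ : 0 < ħ) (hm : 0 < m) (hω : 0 < ω)
    (hD : -(m * ω ^ 2 / N) < D) (k : Fin N) : 0 < modeLength N ħ m ω D k := by
  have h1 := freqMinus_pos hm hω
  have h2 := freqPlus_pos hN hm hD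
  unfold modeLength lengthMinus lengthPlus
  split_ifs <;> exact Real.sqrt_pos.2 (by positivity)

/-- In normal coordinates the potential is a sum of harmonic potentials. -/
theorem potential_eq_sum (hN : 1 ≤ N) (hħ : 0 < ħ) (hm : 0 < m) (hω : 0 < ω)
    (hD : -(m * ω ^ 2 / N) < D) (x : Config N) :
    potential N m ω D x = ∑ k : Fin N, ħ ^ 2 / (2 * m) *
      (inner ℝ (normalBasis hN k) x ^ 2 / modeLength N ħ m ω D k ^ 4) := by
  have h1 := freqMinus_pos hm hω
  have h2 := freqPlus_pos hN hm hD
  have hk : ∀ k : Fin N, ħ ^ 2 / (2 * m) *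
      (inner ℝ (normalBasis hN k) x ^ 2 / modeLength N ħ m ω D k ^ 4) =
      (if (k : ℕ) = 0 then m * ω ^ 2 / 2 else (m * ω ^ 2 + N * D) / 2) *
        normalCoord x k ^ 2 := fun k => by
    rw [inner_normalBasis, modeLength, ← freqPlus_sq hN hm hD, ← freqMinus_sq hm]
    split_ifs
    · rw [show (4 : ℕ) = 2 * 2 from rfl, pow_mul, lengthMinus_sq hħ hm hω]
      field_simp
    · rw [show (4 : ℕ) = 2 * 2 from rfl, pow_mul, lengthPlus_sq hN hħ hm hD]
      field_simp
  rw [Finset.sum_congr rfl fun k _ => hk k, sum_ite_mul_normalCoord_sq hN, potential,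
    sum_sum_Ioi_sub_sq, ← Finset.mul_sum]
  have hN' : (N : ℝ) ≠ 0 := by positivity
  field_simp
  ring

theorem gaussExponent_eq (hN : 1 ≤ N) (x : Config N) :
    -gaussExponent (normalBasis hN) (modeLength N ħ m ω D) x =
      -coeffA N ħ m ω D * ∑ i, x i ^ 2 + coeffB N ħ m ω D * (∑ i, x i) ^ 2 := by
  have hk : ∀ k : Fin N, inner ℝ (normalBasis hN k) x ^ 2 / (2 * modeLength N ħ m ω D k ^ 2) =
      (if (k : ℕ) = 0 then 1 / (2 * lengthMinus ħ m ω ^ 2)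
        else 1 / (2 * lengthPlus N ħ m ω D ^ 2)) * normalCoord x k ^ 2 := fun k => by
    rw [inner_normalBasis, modeLength]
    split_ifs <;> ring
  rw [gaussExponent, Finset.sum_congr rfl fun k _ => hk k, sum_ite_mul_normalCoord_sq hN, coeffA,
    coeffB]
  have hN' : (N : ℝ) ≠ 0 := by positivity
  ring

/-- The number of excitations of the centre of mass mode. -/
def numMinus (ν : Fin N → ℕ) : ℕ := ∑ k ∈ Finset.univ.filter (fun k : Fin N => (k : ℕ) = 0), ν k

/-- The number of excitations of the relative modes. -/
def numPlus (ν : Fin N → ℕ) : ℕ := ∑ k ∈ Finset.univ.filter (fun k : Fin N => (k : ℕ) ≠ 0), ν k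

theorem numMinus_add_numPlus (ν : Fin N → ℕ) : numMinus ν + numPlus ν = ∑ k, ν k :=
  Finset.sum_filter_add_sum_filter_not _ _ _

theorem filter_val_eq_zero (hN : 1 ≤ N) :
    Finset.univ.filter (fun k : Fin N => (k : ℕ) = 0) = {⟨0, hN⟩} := by
  ext k
  simp [Fin.ext_iff]

theorem mem_excitationSet_iff (hN : 1 ≤ N) (ν : Fin N → ℕ) (nMinus nPlus : ℕ) :
    ν ∈ excitationSet N nMinus nPlus ↔ numMinus ν = nMinus ∧ numPlus ν = nPlus := by
  rw [excitationSet, Set.mem_ofPred_eq, numMinus, numPlus, filter_val_eq_zero hN,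
    Finset.sum_singleton]
  refine and_congr_left fun _ => ⟨fun h => h _ rfl, fun h k hk => ?_⟩
  rw [← h]
  congr 1
  exact Fin.ext hk

theorem sum_kinetic_eq_energy (hN : 1 ≤ N) (hħ : 0 < ħ) (hm : 0 < m) (hω : 0 < ω)
    (hD : -(m * ω ^ 2 / N) < D) (ν : Fin N → ℕ) :
    ∑ k, ħ ^ 2 / (2 * m) * ((2 * ν k + 1) / modeLength N ħ m ω D k ^ 2) =
      energy N ħ m ω D (numMinus ν) (numPlus ν) := by
  have h1 := freqMinus_pos hm hω
  have h2 := freqPlus_pos hN hm hD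
  have hmin : ∀ k ∈ Finset.univ.filter (fun k : Fin N => (k : ℕ) = 0),
      ħ ^ 2 / (2 * m) * ((2 * ν k + 1) / modeLength N ħ m ω D k ^ 2) =
        ħ * freqMinus m ω * (ν k + 1 / 2) := fun k hk => by
    rw [modeLength, if_pos (Finset.mem_filter.1 hk).2, lengthMinus_sq hħ hm hω]
    field_simp
  have hplus : ∀ k ∈ Finset.univ.filter (fun k : Fin N => ¬ (k : ℕ) = 0),
      ħ ^ 2 / (2 * m) * ((2 * ν k + 1) / modeLength N ħ m ω D k ^ 2) =
        ħ * freqPlus N m ω D * (ν k + 1 / 2) := fun k hk => by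
    rw [modeLength, if_neg (Finset.mem_filter.1 hk).2, lengthPlus_sq hN hħ hm hD]
    field_simp
  have hcard : ((Finset.univ.filter (fun k : Fin N => ¬ (k : ℕ) = 0)).card : ℝ) = N - 1 := by
    have := Finset.card_filter_add_card_filter_not (s := Finset.univ)
      (fun k : Fin N => (k : ℕ) = 0)
    rw [filter_val_eq_zero hN, Finset.card_singleton, Finset.card_univ, Fintype.card_fin] at this
    exact eq_sub_of_add_eq (by exact_mod_cast (add_comm _ _).trans this)
  rw [← Finset.sum_filter_add_sum_filter_not _ (fun k : Fin N => (k : ℕ) = 0),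
    Finset.sum_congr rfl hmin, Finset.sum_congr rfl hplus, ← Finset.mul_sum, ← Finset.mul_sum,
    Finset.sum_add_distrib, Finset.sum_add_distrib, energy, numMinus, numPlus,
    Finset.sum_const, Finset.sum_const, nsmul_eq_mul, nsmul_eq_mul, hcard, filter_val_eq_zero hN]
  simp only [Finset.sum_singleton, Finset.card_singleton, Nat.cast_one, ne_eq, Nat.cast_sum]
  ring

/-- Since the centre of mass and the relative quantum numbers both cost a positive energy, the least
energy with at least `p` relative excitations is attained at `(0, p)` only. -/
theorem energy_le_energy (hN : 1 ≤ N) (hħ : 0 < ħ) (hm : 0 < m) (hω : 0 < ω)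
    (hD : -(m * ω ^ 2 / N) < D) {a p q : ℕ} (h : p ≤ q) :
    energy N ħ m ω D 0 p ≤ energy N ħ m ω D a q ∧
      (energy N ħ m ω D a q = energy N ħ m ω D 0 p → a = 0 ∧ q = p) := by
  have h1 := mul_pos hħ (freqMinus_pos hm hω)
  have h2 := mul_pos hħ (freqPlus_pos hN hm hD)
  have h3 : energy N ħ m ω D a q - energy N ħ m ω D 0 p =
      ħ * freqMinus m ω * a + ħ * freqPlus N m ω D * ((q : ℝ) - p) := by
    simp only [energy, Nat.cast_zero]
    ring
  have h4 : (0 : ℝ) ≤ (q : ℝ) - p := sub_nonneg.2 (by exact_mod_cast h)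
  have h5 : 0 ≤ ħ * freqMinus m ω * a := by positivity
  have h6 := mul_nonneg h2.le h4
  refine ⟨by linarith, fun he => ?_⟩
  have h7 : ħ * freqMinus m ω * a = 0 := by linarith
  have h8 : ħ * freqPlus N m ω D * ((q : ℝ) - p) = 0 := by linarith
  refine ⟨?_, ?_⟩
  · exact_mod_cast (mul_eq_zero.1 h7).resolve_left h1.ne'
  · exact_mod_cast sub_eq_zero.1 ((mul_eq_zero.1 h8).resolve_left h2.ne')

end Parameters

/-! ### Antisymmetric states -/

theorem coeFn_permOp {N : ℕ} (P : Equiv.Perm (Fin N)) (Ψ : HilbertSpace N) :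
    (permOp N P Ψ : Config N → ℂ) =ᵐ[volume]
      fun x => Ψ (LinearIsometryEquiv.piLpCongrLeft 2 ℝ ℝ P.symm x) :=
  Lp.coeFn_compMeasurePreserving Ψ
    (LinearIsometryEquiv.piLpCongrLeft 2 ℝ ℝ P.symm).measurePreserving

theorem mem_fermionSubspace_iff {N : ℕ} (Ψ : HilbertSpace N) :
    Ψ ∈ fermionSubspace N ↔
      ∀ P : Equiv.Perm (Fin N), permOp N P Ψ = (((Equiv.Perm.sign P : ℤ) : ℂ)) • Ψ := by
  simp [fermionSubspace, Submodule.mem_iInf, LinearMap.mem_ker, sub_eq_zero]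

/-- Permuting the coordinates of the point is renaming the variables by the inverse permutation. -/
theorem eval_piLpCongrLeft {N : ℕ} (P : Equiv.Perm (Fin N)) (x : Config N)
    (p : MvPolynomial (Fin N) ℝ) :
    MvPolynomial.eval (LinearIsometryEquiv.piLpCongrLeft 2 ℝ ℝ P x).ofLp p =
      MvPolynomial.eval x.ofLp (MvPolynomial.rename P.symm p) := by
  rw [MvPolynomial.eval_rename]
  congr 1

section Symmetric

variable {N : ℕ} {b : OrthonormalBasis (Fin N) ℝ (Config N)} {l : Fin N → ℝ}
  (hl : ∀ k, 0 < l k)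
  (hsym : ∀ (P : Equiv.Perm (Fin N)) (x : Config N),
    gaussExponent b l (LinearIsometryEquiv.piLpCongrLeft 2 ℝ ℝ P x) = gaussExponent b l x)

include hsym

theorem inner_polyState_permOp (P : Equiv.Perm (Fin N)) (p : MvPolynomial (Fin N) ℝ)
    (Ψ : HilbertSpace N) :
    inner ℂ (polyState b hl p) (permOp N P Ψ) =
      inner ℂ (polyState b hl (MvPolynomial.rename P.symm p)) Ψ := by
  rw [inner_polyState, inner_polyState, toDistribution_apply, toDistribution_apply]
  set σ := LinearIsometryEquiv.piLpCongrLeft 2 ℝ ℝ P.symm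
  have h1 := σ.measurePreserving.integral_comp σ.toHomeomorph.measurableEmbedding
    (fun x => polyGauss b hl (MvPolynomial.rename P.symm p) x * Ψ x)
  rw [← h1]
  refine integral_congr_ae ?_
  filter_upwards [coeFn_permOp P Ψ] with x hx
  rw [hx, polyGauss_apply, polyGauss_apply, eval_piLpCongrLeft, hsym, MvPolynomial.rename_rename]
  simp [σ]

theorem permOp_polyState (P : Equiv.Perm (Fin N)) (p : MvPolynomial (Fin N) ℝ) :
    permOp N P (polyState b hl p) = polyState b hl (MvPolynomial.rename P p) := by
  refine Lp.ext ?_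
  have h := (LinearIsometryEquiv.piLpCongrLeft 2 ℝ ℝ
    P.symm).measurePreserving.quasiMeasurePreserving.ae_eq_comp (coeFn_polyState b hl p)
  filter_upwards [coeFn_permOp P (polyState b hl p), h,
    coeFn_polyState b hl (MvPolynomial.rename P p)] with x h1 h2 h3
  rw [h1, h3]
  refine h2.trans ?_
  simp only [Function.comp_apply]
  rw [eval_piLpCongrLeft, hsym, Equiv.symm_symm]

theorem polyState_mem_fermionSubspace {p : MvPolynomial (Fin N) ℝ} (hp : IsAlternating p) :
    polyState b hl p ∈ fermionSubspace N := by
  refine (mem_fermionSubspace_iff _).2 fun P => ?_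
  rw [permOp_polyState hl hsym, hp P, ← Int.cast_smul_eq_zsmul ℝ, polyState_smul,
    Complex.ofReal_intCast]

/-- Against antisymmetric states a polynomial may be replaced by its alternatization. -/
theorem inner_polyState_alternatization {Ψ : HilbertSpace N} (hΨ : Ψ ∈ fermionSubspace N)
    (p : MvPolynomial (Fin N) ℝ) :
    inner ℂ (polyState b hl (alternatization p)) Ψ =
      (N.factorial : ℂ) * inner ℂ (polyState b hl p) Ψ := by
  rw [alternatization_apply, map_sum, sum_inner]
  have h : ∀ P : Equiv.Perm (Fin N), inner ℂ (polyState b hl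
      ((Equiv.Perm.sign P : ℤ) • MvPolynomial.rename P p)) Ψ = inner ℂ (polyState b hl p) Ψ := by
    intro P
    have h1 := inner_polyState_permOp hl hsym P.symm p Ψ
    rw [(mem_fermionSubspace_iff Ψ).1 hΨ, inner_smul_right, Equiv.symm_symm] at h1
    rw [← Int.cast_smul_eq_zsmul ℝ, polyState_smul, inner_smul_left, ← h1, Complex.conj_ofReal,
      Complex.ofReal_intCast, ← mul_assoc, ← Int.cast_mul, Equiv.Perm.sign_symm, ← Units.val_mul,
      Int.units_mul_self]
    simp
  rw [Finset.sum_congr rfl fun P _ => h P, Finset.sum_const, Finset.card_univ, Fintype.card_perm,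
    Fintype.card_fin, nsmul_eq_mul]

theorem inner_polyState_mul_eq_zero {Ψ : HilbertSpace N} (hΨ : Ψ ∈ fermionSubspace N)
    {r s : MvPolynomial (Fin N) ℝ} (hr : r.IsSymmetric)
    (hs : s.totalDegree < N * (N - 1) / 2) : inner ℂ (polyState b hl (r * s)) Ψ = 0 := by
  have h := inner_polyState_alternatization hl hsym hΨ (r * s)
  rw [alternatization_mul_of_symmetric hr,
    (isAlternating_alternatization s).eq_zero_of_totalDegree_lt
    ((totalDegree_alternatization_le s).trans_lt hs), mul_zero, map_zero, inner_zero_left] at h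
  exact (mul_eq_zero.1 h.symm).resolve_left (by exact_mod_cast N.factorial_ne_zero)

theorem exists_inner_polyState_eq {s : MvPolynomial (Fin N) ℝ}
    (hs : s.totalDegree ≤ N * (N - 1) / 2) : ∃ κ : ℂ, ∀ Ψ ∈ fermionSubspace N,
      inner ℂ (polyState b hl s) Ψ = κ * inner ℂ (polyState b hl (vandermondePoly N)) Ψ := by
  obtain ⟨c, hc⟩ := (isAlternating_alternatization s).exists_eq_smul
    (isAlternating_vandermondePoly N) ((totalDegree_alternatization_le s).trans hs)
    (totalDegree_vandermondePoly_le N) (vandermondePoly_ne_zero N)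
  refine ⟨(N.factorial : ℂ)⁻¹ * c, fun Ψ hΨ => ?_⟩
  have h := inner_polyState_alternatization hl hsym hΨ s
  have h0 : (N.factorial : ℂ) ≠ 0 := by exact_mod_cast N.factorial_ne_zero
  rw [hc, polyState_smul, inner_smul_left, Complex.conj_ofReal] at h
  rw [mul_assoc, h, inv_mul_cancel_left₀ h0]

end Symmetric

/-! ### The Hamiltonian on Hermite states -/

section Hamiltonian

variable {N : ℕ} {ħ m ω D : ℝ}

/-- The Hamiltonian acting on Schwartz functions. -/
def schwartzHamiltonian (N : ℕ) (ħ m ω D : ℝ) (f : 𝓢(Config N, ℂ)) : 𝓢(Config N, ℂ) :=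
  (-((ħ ^ 2 / (2 * m) : ℝ) : ℂ)) • Δ f +
    SchwartzMap.smulLeftCLM ℂ (fun x : Config N => (potential N m ω D x : ℂ)) f

theorem formalHamiltonian_apply_apply (T : 𝓢'(Config N, ℂ)) (f : 𝓢(Config N, ℂ)) :
    formalHamiltonian N ħ m ω D T f = T (schwartzHamiltonian N ħ m ω D f) := by
  rw [schwartzHamiltonian, map_add, map_smul, ← TemperedDistribution.laplacian_apply_apply,
    ← TemperedDistribution.smulLeftCLM_apply_apply, ← TemperedDistribution.laplacianCLM_apply]
  rfl

theorem schwartzHamiltonian_hermiteState (hN : 1 ≤ N) (hħ : 0 < ħ) (hm : 0 < m) (hω : 0 < ω)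
    (hD : -(m * ω ^ 2 / N) < D) (ν : Fin N → ℕ) :
    schwartzHamiltonian N ħ m ω D (polyGauss (normalBasis hN) (modeLength_pos hN hħ hm hω hD)
        (hermitePoly (normalBasis hN) (modeLength N ħ m ω D) ν)) =
      (energy N ħ m ω D (numMinus ν) (numPlus ν) : ℂ) •
        polyGauss (normalBasis hN) (modeLength_pos hN hħ hm hω hD)
          (hermitePoly (normalBasis hN) (modeLength N ħ m ω D) ν) := by
  ext x
  rw [schwartzHamiltonian, add_apply, smul_apply, smul_apply,
    SchwartzMap.smulLeftCLM_apply_apply (potential_hasTemperateGrowth N m ω D),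
    laplacian_hermiteState, potential_eq_sum hN hħ hm hω hD,
    ← sum_kinetic_eq_energy hN hħ hm hω hD ν, smul_eq_mul, smul_eq_mul, smul_eq_mul, ← mul_assoc,
    ← add_mul]
  congr 1
  norm_cast
  rw [← Finset.mul_sum, ← Finset.mul_sum, Finset.sum_sub_distrib]
  ring

theorem formalHamiltonian_toLp (f : 𝓢(Config N, ℂ)) :
    formalHamiltonian N ħ m ω D (toDistribution N (f.toLp 2 volume)) =
      toDistribution N ((schwartzHamiltonian N ħ m ω D f).toLp 2 volume) := by
  have hpair : ∀ f g : 𝓢(Config N, ℂ),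
      toDistribution N (f.toLp 2 volume) g = ∫ x, g x * f x := fun f g => by
    rw [toDistribution_apply]
    refine integral_congr_ae ?_
    filter_upwards [f.coeFn_toLp 2 volume] with x hx
    rw [hx]
  have hadd : ∀ f g : 𝓢(Config N, ℂ),
      (f + g).toLp 2 (volume : Measure (Config N)) = f.toLp 2 volume + g.toLp 2 volume :=
    fun f g => map_add (SchwartzMap.toLpCLM ℂ ℂ 2 (volume : Measure (Config N))) f g
  have hsmul : ∀ (c : ℂ) (f : 𝓢(Config N, ℂ)),
      (c • f).toLp 2 (volume : Measure (Config N)) = c • f.toLp 2 volume :=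
    fun c f => map_smul (SchwartzMap.toLpCLM ℂ ℂ 2 (volume : Measure (Config N))) c f
  ext g
  rw [formalHamiltonian_apply_apply, schwartzHamiltonian, schwartzHamiltonian, hadd, hsmul,
    map_add, map_smul, map_add, map_smul]
  change _ = (_ : ℂ) • toDistribution N _ g + toDistribution N _ g
  rw [hpair, hpair, hpair, hpair, SchwartzMap.integral_mul_laplacian_right_eq_left]
  congr 1
  refine integral_congr_ae (Filter.Eventually.of_forall fun x => ?_)
  have hV := potential_hasTemperateGrowth N m ω D
  simp only
  rw [SchwartzMap.smulLeftCLM_apply_apply hV, SchwartzMap.smulLeftCLM_apply_apply hV, smul_eq_mul,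
    smul_eq_mul]
  ring

/-- The eigenvalue equation in the domain is the eigenvalue equation in the sense of
distributions. -/
theorem exists_hamiltonian_eq_iff (Ψ : HilbertSpace N) (E : ℂ) :
    (∃ h : Ψ ∈ (hamiltonian N ħ m ω D).domain, hamiltonian N ħ m ω D ⟨Ψ, h⟩ = E • Ψ) ↔
      formalHamiltonian N ħ m ω D (toDistribution N Ψ) = E • toDistribution N Ψ := by
  refine ⟨fun ⟨h, he⟩ => ?_, fun h => ?_⟩
  · rw [← map_smul, ← he, toDistribution_hamiltonian]
  · have hdom : Ψ ∈ (hamiltonian N ħ m ω D).domain := ⟨E • Ψ, by rw [map_smul, ← h]; rfl⟩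
    refine ⟨hdom, toDistribution_injective N ?_⟩
    rw [toDistribution_hamiltonian, h, map_smul]

theorem inner_hermiteBasis_hamiltonian (hN : 1 ≤ N) (hħ : 0 < ħ) (hm : 0 < m) (hω : 0 < ω)
    (hD : -(m * ω ^ 2 / N) < D) (ν : Fin N → ℕ) (Ψ : (hamiltonian N ħ m ω D).domain) :
    inner ℂ (hermiteBasis (normalBasis hN) (modeLength_pos hN hħ hm hω hD) ν)
        (hamiltonian N ħ m ω D Ψ) =
      (energy N ħ m ω D (numMinus ν) (numPlus ν) : ℂ) *
        inner ℂ (hermiteBasis (normalBasis hN) (modeLength_pos hN hħ hm hω hD) ν)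
          (Ψ : HilbertSpace N) := by
  rw [hermiteBasis_apply, inner_polyState, inner_polyState, toDistribution_hamiltonian,
    formalHamiltonian_apply_apply, schwartzHamiltonian_hermiteState hN hħ hm hω hD, map_smul,
    smul_eq_mul]

theorem excitationSpace_eq_span (hN : 1 ≤ N) (hħ : 0 < ħ) (hm : 0 < m) (hω : 0 < ω)
    (hD : -(m * ω ^ 2 / N) < D) (nMinus nPlus : ℕ) :
    excitationSpace N ħ m ω D nMinus nPlus = Submodule.span ℂ
      (hermiteBasis (normalBasis hN) (modeLength_pos hN hħ hm hω hD) ''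
        excitationSet N nMinus nPlus) := by
  rw [excitationSpace]
  congr 1
  ext Φ
  simp only [Set.mem_ofPred_eq, Set.mem_image]
  refine exists_congr fun ν => and_congr_right fun _ => ?_
  have h : (hermiteBasis (normalBasis hN) (modeLength_pos hN hħ hm hω hD) ν : Config N → ℂ)
      =ᵐ[volume] fun x => (productState N ħ m ω D ν x : ℂ) := by
    rw [hermiteBasis_apply]
    filter_upwards [coeFn_polyState (normalBasis hN) (modeLength_pos hN hħ hm hω hD)
      (hermitePoly (normalBasis hN) (modeLength N ħ m ω D) ν)] with x hx
    rw [hx, eval_hermitePoly_mul_exp]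
    simp only [inner_normalBasis]
    rfl
  exact ⟨fun hΦ => Lp.ext (h.trans hΦ.symm), fun hΦ => hΦ ▸ h⟩

theorem formalHamiltonian_of_mem_excitationSpace (hN : 1 ≤ N) (hħ : 0 < ħ) (hm : 0 < m)
    (hω : 0 < ω) (hD : -(m * ω ^ 2 / N) < D) {nMinus nPlus : ℕ} {Ψ : HilbertSpace N}
    (hΨ : Ψ ∈ excitationSpace N ħ m ω D nMinus nPlus) :
    formalHamiltonian N ħ m ω D (toDistribution N Ψ) =
      (energy N ħ m ω D nMinus nPlus : ℂ) • toDistribution N Ψ := by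
  rw [excitationSpace_eq_span hN hħ hm hω hD] at hΨ
  induction hΨ using Submodule.span_induction with
  | zero => rw [← map_smul (toDistribution N), smul_zero, map_zero, map_zero]
  | add Φ Ψ _ _ h1 h2 => rw [map_add, map_add, h1, h2, smul_add]
  | smul c Φ _ h => rw [map_smul, map_smul, h, smul_comm]
  | mem Φ h =>
    obtain ⟨ν, hν, rfl⟩ := h
    obtain ⟨rfl, rfl⟩ := (mem_excitationSet_iff hN ν _ _).1 hν
    rw [hermiteBasis_apply, polyState_eq_toLp, formalHamiltonian_toLp,
      schwartzHamiltonian_hermiteState hN hħ hm hω hD, ← map_smul (toDistribution N)]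
    refine congrArg (toDistribution N) ?_
    exact map_smul (SchwartzMap.toLpCLM ℂ ℂ 2 (volume : Measure (Config N))) _ _

theorem finite_excitationSet (hN : 1 ≤ N) (nMinus nPlus : ℕ) :
    (excitationSet N nMinus nPlus).Finite := by
  refine (Set.finite_Iic (fun _ : Fin N => nMinus + nPlus)).subset fun ν hν k => ?_
  obtain ⟨rfl, rfl⟩ := (mem_excitationSet_iff hN ν _ _).1 hν
  rw [numMinus_add_numPlus]
  exact Finset.single_le_sum (f := ν) (fun _ _ => Nat.zero_le _) (Finset.mem_univ k)

theorem mem_excitationSpace_iff (hN : 1 ≤ N) (hħ : 0 < ħ) (hm : 0 < m) (hω : 0 < ω)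
    (hD : -(m * ω ^ 2 / N) < D) {nMinus nPlus : ℕ} {Ψ : HilbertSpace N} :
    Ψ ∈ excitationSpace N ħ m ω D nMinus nPlus ↔ ∀ ν ∉ excitationSet N nMinus nPlus,
      inner ℂ (hermiteBasis (normalBasis hN) (modeLength_pos hN hħ hm hω hD) ν) Ψ = 0 := by
  set B := hermiteBasis (normalBasis hN) (modeLength_pos hN hħ hm hω hD)
  rw [excitationSpace_eq_span hN hħ hm hω hD]
  refine ⟨fun h ν hν => ?_, fun h => ?_⟩
  · induction h using Submodule.span_induction with
    | zero => simp
    | add Φ Ψ _ _ h1 h2 => rw [inner_add_right, h1, h2, add_zero]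
    | smul c Φ _ h => rw [inner_smul_right, h, mul_zero]
    | mem Φ h =>
      obtain ⟨μ, hμ, rfl⟩ := h
      exact B.orthonormal.inner_eq_zero fun hne => hν (hne ▸ hμ)
  · have h1 := B.hasSum_repr Ψ
    have h2 : HasSum (fun ν => B.repr Ψ ν • B ν)
        (∑ ν ∈ (finite_excitationSet hN nMinus nPlus).toFinset, B.repr Ψ ν • B ν) :=
      hasSum_sum_of_ne_finset_zero fun ν hν => by
        rw [B.repr_apply_apply, h ν (by simpa using hν), zero_smul]
    rw [h1.unique h2]
    exact Submodule.sum_mem _ fun ν hν => Submodule.smul_mem _ _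
      (Submodule.subset_span ⟨ν, by simpa using hν, rfl⟩)

end Hamiltonian

/-! ### The fermionic ground state -/

section GroundState

variable {N : ℕ} {ħ m ω D : ℝ}

theorem sum_piLpCongrLeft (P : Equiv.Perm (Fin N)) (x : Config N) (f : ℝ → ℝ) :
    ∑ i, f (LinearIsometryEquiv.piLpCongrLeft 2 ℝ ℝ P x i) = ∑ i, f (x i) :=
  Equiv.sum_comp P.symm fun i => f (x i)

theorem gaussExponent_piLpCongrLeft (hN : 1 ≤ N) (P : Equiv.Perm (Fin N)) (x : Config N) :
    gaussExponent (normalBasis hN) (modeLength N ħ m ω D)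
        (LinearIsometryEquiv.piLpCongrLeft 2 ℝ ℝ P x) =
      gaussExponent (normalBasis hN) (modeLength N ħ m ω D) x := by
  rw [← neg_inj, gaussExponent_eq, gaussExponent_eq, sum_piLpCongrLeft P x fun t => t ^ 2,
    sum_piLpCongrLeft P x fun t => t]

theorem isSymmetric_linPoly_centre (hN : 1 ≤ N) {k : Fin N} (hk : (k : ℕ) = 0) :
    (linPoly (normalBasis hN k)).IsSymmetric := by
  intro P
  refine MvPolynomial.funext fun x => ?_
  have h := eval_piLpCongrLeft P.symm (WithLp.toLp 2 x) (linPoly (normalBasis hN k))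
  rw [Equiv.symm_symm] at h
  rw [← h]
  change _ = MvPolynomial.eval (WithLp.toLp 2 x : Config N).ofLp _
  rw [eval_linPoly, eval_linPoly, inner_normalBasis, inner_normalBasis, normalCoord, normalCoord,
    if_pos hk, if_pos hk, sum_piLpCongrLeft P.symm _ fun t => t]

/-- The part of a product Hermite polynomial that depends on the relative coordinates. -/
def relativePoly (hN : 1 ≤ N) (l : Fin N → ℝ) (ν : Fin N → ℕ) : MvPolynomial (Fin N) ℝ :=
  ∏ k ∈ Finset.univ.filter (fun k : Fin N => (k : ℕ) ≠ 0),
    hermiteFactor (normalBasis hN) l k (ν k)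

theorem totalDegree_relativePoly_le (hN : 1 ≤ N) (l : Fin N → ℝ) (ν : Fin N → ℕ) :
    (relativePoly hN l ν).totalDegree ≤ numPlus ν :=
  (MvPolynomial.totalDegree_finsetProd _ _).trans
    (Finset.sum_le_sum fun _ _ => totalDegree_hermiteFactor_le _ _ _ _)

theorem hermitePoly_eq_mul (hN : 1 ≤ N) (l : Fin N → ℝ) (ν : Fin N → ℕ) :
    hermitePoly (normalBasis hN) l ν =
      hermiteFactor (normalBasis hN) l ⟨0, hN⟩ (numMinus ν) * relativePoly hN l ν := by
  rw [hermitePoly, ← Finset.prod_filter_mul_prod_filter_not _ (fun k : Fin N => (k : ℕ) = 0),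
    filter_val_eq_zero hN, Finset.prod_singleton, numMinus, filter_val_eq_zero hN,
    Finset.sum_singleton]
  rfl

/-- The centre of mass coordinate is invariant under permutations of the particles. -/
theorem isSymmetric_hermiteFactor_centre (hN : 1 ≤ N) (l : Fin N → ℝ) (n : ℕ) :
    (hermiteFactor (normalBasis hN) l ⟨0, hN⟩ n).IsSymmetric := by
  intro P
  have h := Polynomial.aeval_algHom_apply
    ((MvPolynomial.rename P : MvPolynomial (Fin N) ℝ →ₐ[ℝ] _).restrictScalars ℤ)
    ((Real.sqrt 2 / l ⟨0, hN⟩) • linPoly (normalBasis hN ⟨0, hN⟩)) (Polynomial.hermite n)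
  rw [AlgHom.restrictScalars_apply, AlgHom.restrictScalars_apply, map_smul,
    isSymmetric_linPoly_centre hN rfl P] at h
  rw [hermiteFactor, map_smul, ← h]

/-- The Pauli principle: fewer than `N (N - 1) / 2` relative excitations cannot occur in an
antisymmetric state. The centre of mass factor is symmetric, and the relative factor has too small a
degree for its alternatization to survive. -/
theorem inner_hermiteBasis_eq_zero (hN : 1 ≤ N) (hħ : 0 < ħ) (hm : 0 < m) (hω : 0 < ω)
    (hD : -(m * ω ^ 2 / N) < D) {Ψ : HilbertSpace N} (hΨ : Ψ ∈ fermionSubspace N) {ν : Fin N → ℕ}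
    (hν : numPlus ν < N * (N - 1) / 2) :
    inner ℂ (hermiteBasis (normalBasis hN) (modeLength_pos hN hħ hm hω hD) ν) Ψ = 0 := by
  rw [hermiteBasis_apply, hermitePoly_eq_mul]
  exact inner_polyState_mul_eq_zero _ (gaussExponent_piLpCongrLeft hN) hΨ
    (isSymmetric_hermiteFactor_centre hN _ _) ((totalDegree_relativePoly_le hN _ ν).trans_lt hν)

/-- On antisymmetric states the coefficients of the modes that carry the ground state are all
determined by the overlap with the Vandermonde state. -/
theorem exists_inner_hermiteBasis_eq (hN : 1 ≤ N) (hħ : 0 < ħ) (hm : 0 < m) (hω : 0 < ω)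
    (hD : -(m * ω ^ 2 / N) < D) {ν : Fin N → ℕ} (h0 : numMinus ν = 0)
    (hν : numPlus ν = N * (N - 1) / 2) : ∃ κ : ℂ, ∀ Ψ ∈ fermionSubspace N,
      inner ℂ (hermiteBasis (normalBasis hN) (modeLength_pos hN hħ hm hω hD) ν) Ψ =
        κ * inner ℂ (polyState (normalBasis hN) (modeLength_pos hN hħ hm hω hD)
          (vandermondePoly N)) Ψ := by
  have h : hermitePoly (normalBasis hN) (modeLength N ħ m ω D) ν =
      hermiteNorm 0 (modeLength N ħ m ω D ⟨0, hN⟩) •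
        relativePoly hN (modeLength N ħ m ω D) ν := by
    rw [hermitePoly_eq_mul, h0]
    simp [hermiteFactor]
  rw [hermiteBasis_apply, h]
  exact exists_inner_polyState_eq _ (gaussExponent_piLpCongrLeft hN)
    ((MvPolynomial.totalDegree_smul_le _ _).trans
      ((totalDegree_relativePoly_le hN _ ν).trans hν.le))

theorem vandermondePoly_mem_hermiteSpan {b : OrthonormalBasis (Fin N) ℝ (Config N)}
    {l : Fin N → ℝ} (hl : ∀ k, 0 < l k) :
    vandermondePoly N ∈ hermiteSpan b l (N * (N - 1) / 2) := by
  have hX : ∀ i : Fin N, (MvPolynomial.X i : MvPolynomial (Fin N) ℝ) =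
      linPoly (EuclideanSpace.single i 1) := fun i => by
    simp [linPoly]
  have h := prod_linPoly_mem_hermiteSpan b hl
    (Finset.univ.sigma fun i : Fin N => Finset.Ioi i)
    (fun ij => EuclideanSpace.single ij.1 1 - EuclideanSpace.single ij.2 1)
  rw [Finset.card_sigma, sum_card_Ioi, Finset.prod_sigma] at h
  simpa only [vandermondePoly, hX, map_sub] using h

/-- The Vandermonde state has only Hermite components of total degree at most `N (N - 1) / 2`,
being a polynomial of that degree, and only components with at least `N (N - 1) / 2` relative
excitations, being antisymmetric. This leaves no centre of mass excitation. -/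
theorem polyState_vandermonde_mem_excitationSpace (hN : 1 ≤ N) (hħ : 0 < ħ) (hm : 0 < m)
    (hω : 0 < ω) (hD : -(m * ω ^ 2 / N) < D) :
    polyState (normalBasis hN) (modeLength_pos hN hħ hm hω hD) (vandermondePoly N) ∈
      excitationSpace N ħ m ω D 0 (N * (N - 1) / 2) := by
  rw [mem_excitationSpace_iff hN hħ hm hω hD]
  intro ν hν
  rw [mem_excitationSet_iff hN] at hν
  rcases lt_or_ge (numPlus ν) (N * (N - 1) / 2) with h | h
  · exact inner_hermiteBasis_eq_zero hN hħ hm hω hD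
      (polyState_mem_fermionSubspace _ (gaussExponent_piLpCongrLeft hN)
        (isAlternating_vandermondePoly N)) h
  · rw [← inner_conj_symm, inner_polyState_eq_zero_of_mem_hermiteSpan _ _
      (vandermondePoly_mem_hermiteSpan (modeLength_pos hN hħ hm hω hD)), map_zero]
    intro μ hμ
    rw [← hermiteBasis_apply]
    refine (hermiteBasis _ _).orthonormal.inner_eq_zero fun hne => ?_
    rw [hne, ← numMinus_add_numPlus] at hμ
    omega

theorem polyState_ne_zero {b : OrthonormalBasis (Fin N) ℝ (Config N)} {l : Fin N → ℝ}
    (hl : ∀ k, 0 < l k) {p : MvPolynomial (Fin N) ℝ} (hp : p ≠ 0) : polyState b hl p ≠ 0 := by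
  intro h
  have h1 : polyGauss b hl p = 0 :=
    SchwartzMap.injective_toLp 2 (volume : Measure (Config N)) (h.trans (map_zero
      (SchwartzMap.toLpCLM ℂ ℂ 2 (volume : Measure (Config N)))).symm)
  refine hp (MvPolynomial.funext fun x => ?_)
  have h2 := congrArg (fun f : 𝓢(Config N, ℂ) => f (WithLp.toLp 2 x)) h1
  simp only [polyGauss_apply] at h2
  simpa using h2

/-- Every antisymmetric state in the domain has at least the energy of the Vandermonde state. -/
theorem energy_mul_norm_sq_le (hN : 1 ≤ N) (hħ : 0 < ħ) (hm : 0 < m) (hω : 0 < ω)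
    (hD : -(m * ω ^ 2 / N) < D) (Φ : (hamiltonian N ħ m ω D).domain)
    (hΦ : (Φ : HilbertSpace N) ∈ fermionSubspace N) :
    energy N ħ m ω D 0 (N * (N - 1) / 2) * ‖(Φ : HilbertSpace N)‖ ^ 2 ≤
      (inner ℂ (Φ : HilbertSpace N) (hamiltonian N ħ m ω D Φ)).re := by
  set B := hermiteBasis (normalBasis hN) (modeLength_pos hN hħ hm hω hD)
  have h1 := (Complex.hasSum_re (B.hasSum_inner_mul_inner (Φ : HilbertSpace N) Φ)).mul_left
    (energy N ħ m ω D 0 (N * (N - 1) / 2))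
  have h2 := Complex.hasSum_re (B.hasSum_inner_mul_inner (Φ : HilbertSpace N)
    (hamiltonian N ħ m ω D Φ))
  have h3 : (inner ℂ (Φ : HilbertSpace N) (Φ : HilbertSpace N)).re =
      ‖(Φ : HilbertSpace N)‖ ^ 2 := (norm_sq_eq_re_inner (𝕜 := ℂ) _).symm
  rw [h3] at h1
  refine hasSum_le (fun ν => ?_) h1 h2
  have h4 : (inner ℂ (Φ : HilbertSpace N) (B ν) * inner ℂ (B ν) (Φ : HilbertSpace N)).re =
      ‖inner ℂ (B ν) (Φ : HilbertSpace N)‖ ^ 2 := by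
    rw [← inner_conj_symm, RCLike.conj_mul]
    norm_cast
  rw [inner_hermiteBasis_hamiltonian hN hħ hm hω hD, mul_left_comm, Complex.re_ofReal_mul, h4]
  rcases lt_or_ge (numPlus ν) (N * (N - 1) / 2) with h | h
  · simp [B, inner_hermiteBasis_eq_zero hN hħ hm hω hD hΦ h]
  · exact mul_le_mul_of_nonneg_right (energy_le_energy hN hħ hm hω hD h).1 (sq_nonneg _)

/-- An antisymmetric eigenfunction with the lowest energy is a multiple of the Vandermonde state:
its coefficients are supported on the modes carrying that energy. -/
theorem exists_eq_smul_of_eigenvector (hN : 1 ≤ N) (hħ : 0 < ħ) (hm : 0 < m) (hω : 0 < ω)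
    (hD : -(m * ω ^ 2 / N) < D) {Ψ : HilbertSpace N} (hΨ : Ψ ∈ fermionSubspace N)
    (hdom : Ψ ∈ (hamiltonian N ħ m ω D).domain)
    (heig : hamiltonian N ħ m ω D ⟨Ψ, hdom⟩ =
      (energy N ħ m ω D 0 (N * (N - 1) / 2) : ℂ) • Ψ) :
    ∃ c : ℂ, Ψ = c • polyState (normalBasis hN) (modeLength_pos hN hħ hm hω hD)
      (vandermondePoly N) := by
  set B := hermiteBasis (normalBasis hN) (modeLength_pos hN hħ hm hω hD)
  set V := polyState (normalBasis hN) (modeLength_pos hN hħ hm hω hD) (vandermondePoly N)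
  have hV0 : V ≠ 0 := polyState_ne_zero _ (vandermondePoly_ne_zero N)
  have hVf : V ∈ fermionSubspace N := polyState_mem_fermionSubspace _
    (gaussExponent_piLpCongrLeft hN) (isAlternating_vandermondePoly N)
  have hVS := polyState_vandermonde_mem_excitationSpace hN hħ hm hω hD
  rw [mem_excitationSpace_iff hN hħ hm hω hD] at hVS
  have hΨS : ∀ ν ∉ excitationSet N 0 (N * (N - 1) / 2), inner ℂ (B ν) Ψ = 0 := fun ν hν => by
    rw [mem_excitationSet_iff hN] at hν
    rcases lt_or_ge (numPlus ν) (N * (N - 1) / 2) with h | h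
    · exact inner_hermiteBasis_eq_zero hN hħ hm hω hD hΨ h
    · have h1 := inner_hermiteBasis_hamiltonian hN hħ hm hω hD ν ⟨Ψ, hdom⟩
      rw [heig, inner_smul_right] at h1
      by_contra h2
      have h3 := mul_right_cancel₀ h2 h1
      exact hν ((energy_le_energy hN hħ hm hω hD h).2 (by exact_mod_cast h3.symm))
  have hVV : inner ℂ V V ≠ 0 := inner_self_ne_zero.2 hV0
  refine ⟨inner ℂ V Ψ / inner ℂ V V, sub_eq_zero.1 ?_⟩
  set Φ := Ψ - (inner ℂ V Ψ / inner ℂ V V) • V with hΦdef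
  have hΦ : Φ ∈ fermionSubspace N := sub_mem hΨ (Submodule.smul_mem _ _ hVf)
  have hVΦ : inner ℂ V Φ = 0 := by
    rw [hΦdef, inner_sub_right, inner_smul_right, div_mul_cancel₀ _ hVV, sub_self]
  have hcoeff : ∀ ν, inner ℂ (B ν) Φ = 0 := fun ν => by
    by_cases hν : ν ∈ excitationSet N 0 (N * (N - 1) / 2)
    · obtain ⟨h0, h1⟩ := (mem_excitationSet_iff hN ν _ _).1 hν
      obtain ⟨κ, hκ⟩ := exists_inner_hermiteBasis_eq hN hħ hm hω hD h0 h1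
      rw [hκ Φ hΦ, hVΦ, mul_zero]
    · rw [hΦdef, inner_sub_right, inner_smul_right, hΨS ν hν, hVS ν hν, mul_zero, sub_zero]
  refine (B.hasSum_repr Φ).unique ?_
  simp only [B.repr_apply_apply, hcoeff, zero_smul]
  exact hasSum_zero

end GroundState

end Harmonium
end

theorem mainTheorem11 (N : ℕ) (hN : 1 ≤ N) (ħ m ω D : ℝ) (hħ : 0 < ħ) (hm : 0 < m) (hω : 0 < ω)
    (hD : -(m * ω ^ 2 / N) < D) :
    ∃ (c₀ : ℝ) (Ψ₀ : Harmonium.HilbertSpace N),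
      0 < c₀ ∧ ‖Ψ₀‖ = 1 ∧
      ((Ψ₀ : Harmonium.Config N → ℂ) =ᵐ[volume]
        fun x => ((c₀ * Harmonium.vandermondeGaussian N ħ m ω D x : ℝ) : ℂ)) ∧
      (∀ nMinus nPlus : ℕ, Ψ₀ ∈ Harmonium.excitationSpace N ħ m ω D nMinus nPlus ↔
        nMinus = 0 ∧ nPlus = N * (N - 1) / 2) ∧
      (∀ (E : ℝ) (Ψ : Harmonium.HilbertSpace N),
        Harmonium.IsGroundState (Harmonium.fermionHamiltonian N ħ m ω D) E Ψ ↔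
          E = Harmonium.energy N ħ m ω D 0 (N * (N - 1) / 2) ∧
            ∃ c : ℂ, c ≠ 0 ∧ Ψ = c • Ψ₀) := by
  open Harmonium in
  set V := polyState (normalBasis hN) (modeLength_pos hN hħ hm hω hD) (vandermondePoly N) with hV
  set E₀ := energy N ħ m ω D 0 (N * (N - 1) / 2)
  have hV0 : V ≠ 0 := polyState_ne_zero _ (vandermondePoly_ne_zero N)
  have hVn : 0 < ‖V‖⁻¹ := inv_pos.2 (norm_pos_iff.2 hV0)
  have hVn' : ((‖V‖⁻¹ : ℝ) : ℂ) ≠ 0 := by exact_mod_cast hVn.ne'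
  have hVS : V ∈ excitationSpace N ħ m ω D 0 (N * (N - 1) / 2) :=
    polyState_vandermonde_mem_excitationSpace hN hħ hm hω hD
  have hVf : V ∈ fermionSubspace N := polyState_mem_fermionSubspace _
    (gaussExponent_piLpCongrLeft hN) (isAlternating_vandermondePoly N)
  -- Multiples of the Vandermonde state are eigenvectors in the domain of the restricted operator.
  have heig : ∀ c : ℂ, ∃ h : c • V ∈ (fermionHamiltonian N ħ m ω D).domain,
      fermionHamiltonian N ħ m ω D ⟨c • V, h⟩ = (E₀ : ℂ) • c • V := fun c => by
    obtain ⟨h1, h2⟩ := (exists_hamiltonian_eq_iff (c • V) (E₀ : ℂ)).2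
      (formalHamiltonian_of_mem_excitationSpace hN hħ hm hω hD (Submodule.smul_mem _ c hVS))
    exact ⟨⟨Submodule.smul_mem _ c hVf, h1⟩, h2⟩
  have hlow : ∀ Φ : (fermionHamiltonian N ħ m ω D).domain,
      E₀ * ‖(Φ : HilbertSpace N)‖ ^ 2 ≤
        (inner ℂ (Φ : HilbertSpace N) (fermionHamiltonian N ħ m ω D Φ)).re := fun Φ =>
    energy_mul_norm_sq_le hN hħ hm hω hD ⟨Φ, Φ.2.2⟩ Φ.2.1
  have hself : ∀ (E : ℝ) (Ψ : HilbertSpace N),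
      (inner ℂ Ψ ((E : ℂ) • Ψ)).re = E * ‖Ψ‖ ^ 2 := fun E Ψ => by
    rw [inner_smul_right, Complex.re_ofReal_mul, norm_sq_eq_re_inner (𝕜 := ℂ)]
    rfl
  refine ⟨‖V‖⁻¹, ((‖V‖⁻¹ : ℝ) : ℂ) • V, hVn, ?_, ?_, fun nMinus nPlus => ⟨fun h => ?_, ?_⟩,
    fun E Ψ => ⟨fun ⟨hΨ0, ⟨hdom, hΨ⟩, hmin⟩ => ?_, ?_⟩⟩
  · rw [norm_smul, Complex.norm_real, Real.norm_of_nonneg hVn.le,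
      inv_mul_cancel₀ (norm_ne_zero_iff.2 hV0)]
  · filter_upwards [Lp.coeFn_smul ((‖V‖⁻¹ : ℝ) : ℂ) V, coeFn_polyState (normalBasis hN)
      (modeLength_pos hN hħ hm hω hD) (vandermondePoly N)] with x h1 h2
    rw [h1, Pi.smul_apply, hV, h2, smul_eq_mul, ← Complex.ofReal_mul, gaussExponent_eq]
    simp [vandermondeGaussian, vandermondePoly]
  · -- A state in two different excitation spaces has no nonzero Hermite coefficient.
    rw [Submodule.smul_mem_iff _ hVn', mem_excitationSpace_iff hN hħ hm hω hD] at h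
    rw [mem_excitationSpace_iff hN hħ hm hω hD] at hVS
    by_contra hne
    refine hV0 (((hermiteBasis (normalBasis hN)
      (modeLength_pos hN hħ hm hω hD)).hasSum_repr V).unique ?_)
    have hzero : ∀ ν, inner ℂ (hermiteBasis (normalBasis hN)
        (modeLength_pos hN hħ hm hω hD) ν) V = 0 := fun ν => by
      by_cases hν : ν ∈ excitationSet N 0 (N * (N - 1) / 2)
      · refine h ν fun hν' => hne ?_
        rw [mem_excitationSet_iff hN] at hν hν'
        exact ⟨hν'.1.symm.trans hν.1, hν'.2.symm.trans hν.2⟩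
      · exact hVS ν hν
    simp only [HilbertBasis.repr_apply_apply, hzero, zero_smul]
    exact hasSum_zero
  · rintro ⟨rfl, rfl⟩
    exact Submodule.smul_mem _ _ hVS
  · -- Comparing `Ψ` and `V` as trial states of each other's minimality gives `E = E₀`.
    have hpos : ∀ Φ : HilbertSpace N, Φ ≠ 0 → 0 < ‖Φ‖ ^ 2 := fun Φ hΦ =>
      pow_pos (norm_pos_iff.2 hΦ) 2
    have hE : E = E₀ := by
      refine le_antisymm ?_ ?_
      · obtain ⟨h1, h2⟩ := heig 1
        have h3 := hmin ⟨(1 : ℂ) • V, h1⟩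
        rw [h2, hself] at h3
        exact le_of_mul_le_mul_right h3 (hpos _ (smul_ne_zero one_ne_zero hV0))
      · have h3 := hlow ⟨Ψ, hdom⟩
        rw [hΨ, hself] at h3
        exact le_of_mul_le_mul_right h3 (hpos _ hΨ0)
    subst hE
    obtain ⟨c, hc⟩ := exists_eq_smul_of_eigenvector hN hħ hm hω hD hdom.1 hdom.2 hΨ
    refine ⟨rfl, c * ((‖V‖⁻¹ : ℝ) : ℂ)⁻¹, mul_ne_zero ?_ (inv_ne_zero hVn'), ?_⟩
    · rintro rfl
      exact hΨ0 (by rw [hc, zero_smul])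
    · rw [smul_smul, inv_mul_cancel_right₀ hVn']
      exact hc
  · rintro ⟨rfl, c, hc, rfl⟩
    rw [smul_smul]
    exact ⟨smul_ne_zero (mul_ne_zero hc hVn') hV0, heig _, hlow⟩
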